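/- Let $n\ge 1$ be an integer and $\sigma>0$. Let $\mathrm{PN}(n,\sigma^2)$ denote the law of $X_1X_2\cdots X_n$, where the $X_i\sim N(0,\sigma_i^2)$ are independent and $\sigma_1\sigma_2\cdots\sigma_n=\sigma$ (this law depends on the $\sigma_i$ only through their product). Write $Tf(x)=xf'(x)$ and $$A_nf(x)=x^{-1}T^nf(x)=\frac{\mathrm d}{\mathrm dx}\big(T^{n-1}f\big)(x),$$ where the last expression defines $A_nf$ also at $x=0$. (1) Let $Z$ be a real-valued random variable with mean zero and finite, non-zero variance. Then $Z$ has law $\mathrm{PN}(n,\sigma^2)$ if and only if, for all $f:\mathbb R\to\mathbb R$ such that $f\in C^n(\mathbb R)$, $\mathbb E|Wf(W)|<\infty$ and $\mathbb E|W^{k-1}f^{(k)}(W)|<\infty$ for $k=1,\dots,n$, where $W\sim\mathrm{PN}(n,\sigma^2)$, the random variable $\sigma^2A_nf(Z)-Zf(Z)$ is integrable and $$\mathbb E[\sigma^2A_nf(Z)-Zf(Z)]=0.$$ (2) For a random variable $W$ with mean zero and finite, non-zero variance, say that $W^{*}$ has the $W$-zero biased distribution of order $n$ if $\mathbb E[Wf(W)]=\mathrm{Var}(W)\,\mathbb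 E[A_nf(W^{*})]$ for all $n$ times differentiable $f:\mathbb R\to\mathbb R$ for which both $Wf(W)$ and $A_nf(W^*)$ are integrable. Then $\mathrm{PN}(n,\sigma^2)$ is the unique fixed point of this transformation with variance $\sigma^2$: a probability measure $\mu$ on $\mathbb R$ is the law of a mean zero random variable $W$ with variance $\sigma^2$ such that $W$ itself has the $W$-zero biased distribution of order $n$ if and only if $\mu=\mathrm{PN}(n,\sigma^2)$. -/

import Mathlib

open MeasureTheory ProbabilityTheory

/-- The law of `X₁ X₂ ⋯ Xₙ` where `σ` is the product `σ₁ ⋯ σₙ` and the `Xᵢ ~ N(0, σᵢ²)` are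
independent. This is the law `PN(n, σ²)`. It is written here as the law of `σ ∏ᵢ Nᵢ` with
independent standard normal `Nᵢ`; `productNormal_eq_map_prod` shows that it is the law of
`X₁ ⋯ Xₙ` for every choice of the `σᵢ` with product `σ`. -/
noncomputable def productNormal (n : ℕ) (σ : ℝ) : Measure ℝ :=
  (Measure.pi fun _ : Fin n => gaussianReal 0 1).map fun x => σ * ∏ i, x i

theorem productNormal_eq_map_prod {Ω : Type*} [MeasurableSpace Ω] {P : Measure Ω}
    [IsProbabilityMeasure P] {n : ℕ} (σ : Fin n → ℝ) (X : Fin n → Ω → ℝ)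
    (hm : ∀ i, AEMeasurable (X i) P)
    (hX : ∀ i, P.map (X i) = gaussianReal 0 (NNReal.mk (σ i ^ 2) (sq_nonneg (σ i))))
    (hind : iIndepFun X P) :
    P.map (fun ω => ∏ i, X i ω) = productNormal n (∏ i, σ i) := by
  have h1 : P.map (fun ω i => X i ω) =
      (Measure.pi fun _ : Fin n => gaussianReal 0 1).map fun x i => σ i * x i := by
    rw [(iIndepFun_iff_map_fun_eq_pi_map hm).1 hind,
      Measure.pi_map_pi (fun i => (measurable_const_mul (σ i)).aemeasurable)]
    congr 1
    funext i
    rw [hX i]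
    simp [gaussianReal_map_const_mul]
  have hp : Measurable fun x : Fin n → ℝ => ∏ i, x i := by fun_prop
  have h2 : P.map (fun ω => ∏ i, X i ω) =
      (P.map (fun ω i => X i ω)).map fun x : Fin n → ℝ => ∏ i, x i := by
    rw [AEMeasurable.map_map_of_aemeasurable hp.aemeasurable (aemeasurable_pi_lambda _ hm)]
    rfl
  rw [h2, h1, Measure.map_map hp (by fun_prop), productNormal]
  congr 1
  funext x
  simp [Finset.prod_mul_distrib]

/-- The operator `T f(x) = x f'(x)`. -/
noncomputable def opT (f : ℝ → ℝ) : ℝ → ℝ := fun x => x * deriv f x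

/-- The operator `Aₙ f = x⁻¹ Tⁿ f = (d/dx)(Tⁿ⁻¹ f)`, for `n ≥ 1`. The second expression is used,
because it also gives the value at `x = 0`. -/
noncomputable def opA (n : ℕ) (f : ℝ → ℝ) : ℝ → ℝ := deriv (opT^[n - 1] f)

theorem opA_eq_inv_mul {n : ℕ} (hn : 1 ≤ n) (f : ℝ → ℝ) {x : ℝ} (hx : x ≠ 0) :
    opA n f x = x⁻¹ * (opT^[n] f) x := by
  obtain ⟨m, rfl⟩ : ∃ m, n = m + 1 := ⟨n - 1, by omega⟩
  rw [Function.iterate_succ_apply']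
  simp [opA, opT, hx]

/-- `f` is `n` times differentiable on `ℝ` (the `n`-th derivative need not be continuous). -/
def TimesDifferentiable (n : ℕ) (f : ℝ → ℝ) : Prop :=
  ∀ k < n, Differentiable ℝ (iteratedDeriv k f)

/-- `μ` is the law of a mean zero random variable `W` with finite, non-zero variance, and `ν` is
a `W`-zero biased distribution of order `n`: for `W* ~ ν`, `E[W f(W)] = Var(W) E[Aₙ f(W*)]` for
all `n` times differentiable `f` for which the two expectations exist. -/
structure IsZeroBiasLaw (n : ℕ) (μ ν : Measure ℝ) : Prop where
  isProbabilityMeasure_left : IsProbabilityMeasure μ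
  memLp_two : MemLp (fun x : ℝ => x) 2 μ
  mean_eq_zero : ∫ x, x ∂μ = 0
  variance_ne_zero : variance (fun x : ℝ => x) μ ≠ 0
  isProbabilityMeasure_right : IsProbabilityMeasure ν
  integral_eq : ∀ f : ℝ → ℝ, TimesDifferentiable n f →
    Integrable (fun x => x * f x) μ → Integrable (opA n f) ν →
    ∫ x, x * f x ∂μ = variance (fun x : ℝ => x) μ * ∫ x, opA n f x ∂ν

/-! Stein's identity goes by induction on `n`, starting from the Dirac mass at `σ` for `n = 0`.
Write `W = X V` with `X` standard normal and `V` a product of one factor fewer. The Gaussian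
identity in `X` at fixed `V` turns `E[W f(W)]` into `E[V · V f'(XV)]`. For fixed `x ≠ 0` the
function `v ↦ v f'(x v)` is a dilate of `T f`, and `T` commutes with dilations, so the induction
hypothesis applies in `V`. The exchanges of integrals rest on `E|X f(X)| ≤ E|f'(X)|` for `f(0) = 0`,
which the same induction carries to `E|W f(W)| ≤ σ² E|Aₙ f(W)|` (`lintegral_mul_productNormal_le`).

For uniqueness, one-sided powers are eigenfunctions of `T`. Testing against them gives `M(s+2) = σ²
(s+1)ⁿ M(s)` for `M(s) = E[(εZ)₊ˢ]`, `ε = ±1`. Since `M` is the moment generating function of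
`log(εZ)` on `εZ > 0`, it is log-convex, and a Bohr–Mollerup argument
(`ConvexOn.sub_eq_sub_of_difference_eq`) fixes it up to a factor. Analytic continuation to the
imaginary axis then fixes each half of the law up to a factor. Mean zero makes the two factors
equal, the variance makes them 1, and total mass settles the atom at 0.

The moments must first be shown to exist. In (1) the integrability of `σ² Aₙ f(Z) - Z f(Z)` is part
of the hypothesis, and the higher power dominates it. In (2) it is not, and bounded smooth
truncations of odd powers give the even moments inductively. -/

/-! ### Stein's identity for the standard normal law -/

theorem hasDerivAt_gaussianPDFReal_zero_one (x : ℝ) :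
    HasDerivAt (gaussianPDFReal 0 1) (-(x * gaussianPDFReal 0 1 x)) x := by
  have h : HasDerivAt (fun y : ℝ => -(y - 0) ^ 2 / (2 * ((1 : NNReal) : ℝ))) (-x) x := by
    have := (((hasDerivAt_id x).sub_const 0).pow 2).neg.div_const (2 * ((1 : NNReal) : ℝ))
    refine this.congr_deriv ?_
    simp
    ring
  refine ((h.exp).const_mul (√(2 * Real.pi * ((1 : NNReal) : ℝ)))⁻¹).congr_deriv ?_
  rw [gaussianPDFReal_def]
  ring

theorem tendsto_gaussianPDFReal_zero_one_atTop :
    Filter.Tendsto (gaussianPDFReal 0 1) Filter.atTop (nhds 0) := by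
  rw [gaussianPDFReal_def]
  have h : Filter.Tendsto (fun x : ℝ => (x - 0) ^ 2 / (2 * ((1 : NNReal) : ℝ)))
      Filter.atTop Filter.atTop := by
    simp only [sub_zero, NNReal.coe_one, mul_one]
    exact (Filter.tendsto_pow_atTop two_ne_zero).atTop_div_const two_pos
  have h2 := (Real.tendsto_exp_neg_atTop_nhds_zero.comp h).const_mul
    (√(2 * Real.pi * ((1 : NNReal) : ℝ)))⁻¹
  simpa only [Function.comp_def, mul_zero, neg_div] using h2

theorem lintegral_Ioi_mul_gaussianPDFReal {t : ℝ} (ht : 0 ≤ t) :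
    ∫⁻ x in Set.Ioi t, ENNReal.ofReal (x * gaussianPDFReal 0 1 x) =
      ENNReal.ofReal (gaussianPDFReal 0 1 t) := by
  have hd : ∀ x ∈ Set.Ici t, HasDerivAt (fun y => -gaussianPDFReal 0 1 y)
      (x * gaussianPDFReal 0 1 x) x := fun x _ =>
    (hasDerivAt_gaussianPDFReal_zero_one x).neg.congr_deriv (neg_neg _)
  have hpos : ∀ x ∈ Set.Ioi t, 0 ≤ x * gaussianPDFReal 0 1 x := fun x hx =>
    mul_nonneg (ht.trans (le_of_lt hx)) (gaussianPDFReal_nonneg _ _ _)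
  have hlim : Filter.Tendsto (fun y => -gaussianPDFReal 0 1 y) Filter.atTop (nhds 0) := by
    simpa using tendsto_gaussianPDFReal_zero_one_atTop.neg
  have hi := integrableOn_Ioi_deriv_of_nonneg' hd hpos hlim
  rw [← ofReal_integral_eq_lintegral_ofReal hi
    ((ae_restrict_iff' measurableSet_Ioi).2 (.of_forall hpos)),
    integral_Ioi_of_hasDerivAt_of_nonneg' hd hpos hlim]
  simp

theorem gaussianPDFReal_zero_neg (x : ℝ) :
    gaussianPDFReal 0 1 (-x) = gaussianPDFReal 0 1 x := by
  simp [gaussianPDFReal_def]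

theorem lintegral_Iio_neg_mul_gaussianPDFReal {t : ℝ} (ht : t ≤ 0) :
    ∫⁻ x in Set.Iio t, ENNReal.ofReal (-x * gaussianPDFReal 0 1 x) =
      ENNReal.ofReal (gaussianPDFReal 0 1 t) := by
  have h := lintegral_Ioi_mul_gaussianPDFReal (neg_nonneg.2 ht)
  rw [gaussianPDFReal_zero_neg] at h
  rw [← h, ← lintegral_indicator measurableSet_Iio, ← lintegral_indicator measurableSet_Ioi,
    ← lintegral_neg_eq_self]
  congr 1
  funext x
  by_cases hx : -x < t
  · rw [Set.indicator_of_mem (by simpa using hx), Set.indicator_of_mem (by simp; linarith),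
      gaussianPDFReal_zero_neg, neg_neg]
  · rw [Set.indicator_of_notMem (by simpa using hx), Set.indicator_of_notMem (by simp; linarith)]

theorem enorm_le_lintegral_deriv {f : ℝ → ℝ} (hf : Differentiable ℝ f) (h0 : f 0 = 0) (x : ℝ) :
    ‖f x‖ₑ ≤ ∫⁻ t in Set.uIoc 0 x, ‖deriv f t‖ₑ := by
  -- Once the right side is finite, `deriv f` is integrable and the fundamental theorem of calculus
  -- needs no continuity of it.
  by_cases hfin : ∫⁻ t in Set.uIoc 0 x, ‖deriv f t‖ₑ = ⊤
  · simp [hfin]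
  have hi : IntegrableOn (deriv f) (Set.uIoc 0 x) :=
    ⟨(measurable_deriv f).aestronglyMeasurable, lt_top_iff_ne_top.2 hfin⟩
  have h := intervalIntegral.integral_eq_sub_of_hasDerivAt (fun y _ => (hf y).hasDerivAt)
    (intervalIntegrable_iff.2 hi)
  rw [h0, sub_zero] at h
  rw [← h, ← ofReal_norm, intervalIntegral.norm_intervalIntegral_eq, ofReal_norm]
  exact enorm_integral_le_lintegral_enorm _

theorem lintegral_gaussianReal_zero_one (g : ℝ → ENNReal) :
    ∫⁻ x, g x ∂(gaussianReal 0 1) = ∫⁻ x, ENNReal.ofReal (gaussianPDFReal 0 1 x) * g x := by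
  rw [gaussianReal_of_var_ne_zero _ one_ne_zero,
    lintegral_withDensity_eq_lintegral_mul_non_measurable _ (measurable_gaussianPDF 0 1)
      (.of_forall fun _ => gaussianPDF_lt_top)]
  rfl

/-- A point `t` lies between 0 and `x` only if `x` is beyond `t` on the same side, so what is
integrated is at most a Gaussian tail. This is the inner integral after Tonelli in the inequality
below. -/
theorem lintegral_uIoc_kernel_le (t : ℝ) :
    ∫⁻ x, (Set.uIoc 0 x).indicator (fun _ => ENNReal.ofReal (|x| * gaussianPDFReal 0 1 x)) t ≤
      ENNReal.ofReal (gaussianPDFReal 0 1 t) := by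
  rcases lt_or_ge 0 t with ht | ht
  · rw [← lintegral_Ioi_mul_gaussianPDFReal ht.le, setLIntegral_congr Ioi_ae_eq_Ici,
      ← lintegral_indicator measurableSet_Ici]
    refine lintegral_mono fun x => ?_
    by_cases hx : t ∈ Set.uIoc 0 x
    · have hx' : t ≤ x := by
        rcases Set.mem_uIoc.1 hx with h | h
        · exact h.2
        · exact absurd h.2 (not_le.2 ht)
      rw [Set.indicator_of_mem hx, Set.indicator_of_mem (Set.mem_Ici.2 hx'),
        abs_of_nonneg (ht.le.trans hx')]
    · rw [Set.indicator_of_notMem hx]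
      exact zero_le
  · rw [← lintegral_Iio_neg_mul_gaussianPDFReal ht, ← lintegral_indicator measurableSet_Iio]
    refine lintegral_mono fun x => ?_
    by_cases hx : t ∈ Set.uIoc 0 x
    · have hx' : x < t := by
        rcases Set.mem_uIoc.1 hx with h | h
        · exact absurd h.1 (not_lt.2 ht)
        · exact h.1
      rw [Set.indicator_of_mem hx, Set.indicator_of_mem (Set.mem_Iio.2 hx'),
        abs_of_nonpos (hx'.le.trans ht)]
    · rw [Set.indicator_of_notMem hx]
      exact zero_le

theorem measurable_uIoc_kernel : Measurable fun p : ℝ × ℝ =>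
    (Set.uIoc 0 p.1).indicator
      (fun _ => ENNReal.ofReal (|p.1| * gaussianPDFReal 0 1 p.1)) p.2 := by
  have hS : MeasurableSet {p : ℝ × ℝ | p.2 ∈ Set.uIoc 0 p.1} := by
    have : {p : ℝ × ℝ | p.2 ∈ Set.uIoc 0 p.1} =
        {p | min 0 p.1 < p.2} ∩ {p | p.2 ≤ max 0 p.1} := rfl
    rw [this]
    exact (measurableSet_lt (by fun_prop) (by fun_prop)).inter
      (measurableSet_le (by fun_prop) (by fun_prop))
  have hg : Measurable fun p : ℝ × ℝ =>
      ENNReal.ofReal (|p.1| * gaussianPDFReal 0 1 p.1) :=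
    ((by fun_prop : Measurable fun p : ℝ × ℝ => |p.1|).mul
      ((measurable_gaussianPDFReal 0 1).comp measurable_fst)).ennreal_ofReal
  exact hg.indicator hS

/-- A weighted Poincaré-type inequality for the standard normal law. -/
theorem lintegral_mul_le_lintegral_deriv_gaussianReal {f : ℝ → ℝ} (hf : Differentiable ℝ f)
    (h0 : f 0 = 0) :
    ∫⁻ x, ‖x * f x‖ₑ ∂(gaussianReal 0 1) ≤ ∫⁻ x, ‖deriv f x‖ₑ ∂(gaussianReal 0 1) := by
  rw [lintegral_gaussianReal_zero_one, lintegral_gaussianReal_zero_one]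
  have hD : Measurable fun t => ‖deriv f t‖ₑ := (measurable_deriv f).enorm
  calc ∫⁻ x, ENNReal.ofReal (gaussianPDFReal 0 1 x) * ‖x * f x‖ₑ
      ≤ ∫⁻ x, ∫⁻ t, (Set.uIoc 0 x).indicator
          (fun _ => ENNReal.ofReal (|x| * gaussianPDFReal 0 1 x)) t * ‖deriv f t‖ₑ := by
        refine lintegral_mono fun x => ?_
        have h1 : ∀ t, (Set.uIoc 0 x).indicator
          (fun _ => ENNReal.ofReal (|x| * gaussianPDFReal 0 1 x)) t * ‖deriv f t‖ₑ =
            ENNReal.ofReal (|x| * gaussianPDFReal 0 1 x) *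
              (Set.uIoc 0 x).indicator (fun t => ‖deriv f t‖ₑ) t := fun t => by
          by_cases ht : t ∈ Set.uIoc 0 x <;> simp [ht]
        simp only [h1]
        rw [lintegral_const_mul _ (hD.indicator measurableSet_uIoc),
          lintegral_indicator measurableSet_uIoc, enorm_mul, ENNReal.ofReal_mul (abs_nonneg x),
          ← Real.enorm_eq_ofReal_abs, mul_left_comm, mul_assoc]
        gcongr
        exact enorm_le_lintegral_deriv hf h0 x
    _ = ∫⁻ t, (∫⁻ x, (Set.uIoc 0 x).indicator
          (fun _ => ENNReal.ofReal (|x| * gaussianPDFReal 0 1 x)) t) * ‖deriv f t‖ₑ := by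
        rw [lintegral_lintegral_swap]
        · refine lintegral_congr fun t => lintegral_mul_const _ ?_
          exact measurable_uIoc_kernel.comp (measurable_id.prodMk measurable_const)
        · exact (measurable_uIoc_kernel.mul (hD.comp measurable_snd)).aemeasurable
    _ ≤ _ := by
        refine lintegral_mono fun t => ?_
        gcongr
        exact lintegral_uIoc_kernel_le t

theorem integrable_gaussianReal_zero_one_iff {g : ℝ → ℝ} :
    Integrable g (gaussianReal 0 1) ↔ Integrable fun x => g x * gaussianPDFReal 0 1 x := by
  rw [gaussianReal_of_var_ne_zero _ one_ne_zero,
    integrable_withDensity_iff (measurable_gaussianPDF 0 1)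
      (.of_forall fun _ => gaussianPDF_lt_top)]
  simp only [toReal_gaussianPDF]

/-- **Stein's identity** for the standard normal law. -/
theorem integral_mul_eq_integral_deriv_gaussianReal {f : ℝ → ℝ} (hf : Differentiable ℝ f)
    (h0 : f 0 = 0) (hi : Integrable (deriv f) (gaussianReal 0 1)) :
    ∫ x, x * f x ∂(gaussianReal 0 1) = ∫ x, deriv f x ∂(gaussianReal 0 1) := by
  have hxf : Integrable (fun x => x * f x) (gaussianReal 0 1) :=
    ⟨(continuous_id.mul hf.continuous).aestronglyMeasurable,
      (lintegral_mul_le_lintegral_deriv_gaussianReal hf h0).trans_lt hi.2⟩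
  -- Integration by parts also needs `f` itself integrable: it is bounded on `[-1, 1]` and dominated
  -- by `x f(x)` outside.
  have hff : Integrable f (gaussianReal 0 1) := by
    obtain ⟨M, hM⟩ := (isCompact_Icc (a := (-1 : ℝ)) (b := 1)).exists_bound_of_continuousOn
      hf.continuous.continuousOn
    refine ((integrable_const M).add hxf.norm).mono' hf.continuous.aestronglyMeasurable
      (.of_forall fun x => ?_)
    simp only [Pi.add_apply, norm_mul]
    have hM0 : 0 ≤ M := (norm_nonneg _).trans (hM 0 (by simp))
    rcases le_or_gt ‖x‖ 1 with hx | hx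
    · have := hM x (abs_le.1 hx)
      have := mul_nonneg (norm_nonneg x) (norm_nonneg (f x))
      linarith
    · have := le_mul_of_one_le_left (norm_nonneg (f x)) hx.le
      linarith
  have h := integral_mul_deriv_eq_deriv_mul_of_integrable
    (fun x _ => (hf x).hasDerivAt) (fun x _ => hasDerivAt_gaussianPDFReal_zero_one x)
    ((integrable_gaussianReal_zero_one_iff.1 hxf).neg.congr (.of_forall fun x => by
      simp only [Pi.neg_apply, Pi.mul_apply]; ring))
    (integrable_gaussianReal_zero_one_iff.1 hi) (integrable_gaussianReal_zero_one_iff.1 hff)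
  simp only [integral_gaussianReal_eq_integral_smul one_ne_zero, smul_eq_mul]
  calc ∫ x, gaussianPDFReal 0 1 x * (x * f x)
      = -∫ x, f x * -(x * gaussianPDFReal 0 1 x) := by
        rw [← integral_neg]
        exact integral_congr_ae (.of_forall fun x => by ring)
    _ = ∫ x, deriv f x * gaussianPDFReal 0 1 x := by rw [h, neg_neg]
    _ = ∫ x, gaussianPDFReal 0 1 x * deriv f x :=
        integral_congr_ae (.of_forall fun x => mul_comm _ _)

/-! ### Recursive structure of the product normal law -/

instance productNormal.instIsProbabilityMeasure (n : ℕ) (σ : ℝ) :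
    IsProbabilityMeasure (productNormal n σ) :=
  Measure.isProbabilityMeasure_map (by fun_prop)

theorem productNormal_zero (σ : ℝ) : productNormal 0 σ = Measure.dirac σ := by
  simp [productNormal]

/-- One standard normal coordinate is split off and `σ` stays with the others, so the recursion ends
at the Dirac mass at `σ`. -/
theorem productNormal_succ (n : ℕ) (σ : ℝ) :
    productNormal (n + 1) σ =
      ((gaussianReal 0 1).prod (productNormal n σ)).map fun p => p.1 * p.2 := by
  have h := (measurePreserving_piFinSuccAbove (fun _ : Fin (n + 1) => gaussianReal 0 1) 0).map_eq
  have hm : Measurable fun x : Fin n → ℝ => σ * ∏ i, x i := by fun_prop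
  have h2 : (gaussianReal 0 1).prod (productNormal n σ) =
      ((gaussianReal 0 1).prod (Measure.pi fun _ : Fin n => gaussianReal 0 1)).map
        (Prod.map id fun x => σ * ∏ i, x i) := by
    rw [← Measure.map_prod_map _ _ measurable_id hm, Measure.map_id]
    rfl
  rw [h2, ← h, Measure.map_map (by fun_prop) (by fun_prop),
    Measure.map_map (by fun_prop) (by fun_prop), productNormal]
  congr 1
  funext x
  simp [Fin.prod_univ_succ, MeasurableEquiv.piFinSuccAbove, Fin.tail]
  ring

theorem ae_gaussianReal_ne_zero : ∀ᵐ x ∂(gaussianReal 0 1), x ≠ 0 := by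
  have := nullSingletonClass_gaussianReal (μ := 0) (one_ne_zero (α := NNReal))
  exact Measure.ae_ne _ 0

theorem ae_productNormal_ne_zero (n : ℕ) {σ : ℝ} (hσ : σ ≠ 0) :
    ∀ᵐ x ∂(productNormal n σ), x ≠ 0 := by
  induction n with
  | zero => rw [productNormal_zero, ae_dirac_eq]; exact hσ
  | succ n ih =>
    rw [productNormal_succ]
    refine (ae_map_iff (by fun_prop) (measurableSet_singleton (0 : ℝ)).compl).2 ?_
    filter_upwards [Measure.quasiMeasurePreserving_fst.ae ae_gaussianReal_ne_zero,
      Measure.quasiMeasurePreserving_snd.ae ih] with p h1 h2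
    exact mul_ne_zero h1 h2

/-! ### Dilation invariance of `T` -/

theorem opT_const_mul_comp_mul (c a : ℝ) (f : ℝ → ℝ) :
    opT (fun x => c * f (a * x)) = fun x => c * opT f (a * x) := by
  funext x
  have h : deriv (fun y => f (a * y)) x = a * deriv f (a * x) := by
    simpa using deriv_comp_mul_left a f x
  simp only [opT, deriv_const_mul_field', h]
  ring

theorem opT_iterate_const_mul_comp_mul (k : ℕ) (c a : ℝ) (f : ℝ → ℝ) :
    opT^[k] (fun x => c * f (a * x)) = fun x => c * (opT^[k] f) (a * x) := by
  induction k generalizing f with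
  | zero => rfl
  | succ k ih => rw [Function.iterate_succ_apply, opT_const_mul_comp_mul, ih,
      Function.iterate_succ_apply]

/-- The first `n` iterates `f, T f, …, Tⁿ⁻¹ f` are differentiable. -/
def IteratesDifferentiable (n : ℕ) (f : ℝ → ℝ) : Prop :=
  ∀ k < n, Differentiable ℝ (opT^[k] f)

theorem IteratesDifferentiable.differentiable {n : ℕ} {f : ℝ → ℝ}
    (hf : IteratesDifferentiable (n + 1) f) : Differentiable ℝ f :=
  hf 0 n.succ_pos

theorem IteratesDifferentiable.opT {n : ℕ} {f : ℝ → ℝ}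
    (hf : IteratesDifferentiable (n + 1) f) : IteratesDifferentiable n (opT f) :=
  fun k hk => hf (k + 1) (Nat.succ_lt_succ hk)

theorem IteratesDifferentiable.const_mul_comp_mul {n : ℕ} {f : ℝ → ℝ}
    (hf : IteratesDifferentiable n f) (c a : ℝ) :
    IteratesDifferentiable n fun x => c * f (a * x) := fun k hk => by
  rw [opT_iterate_const_mul_comp_mul]
  have := hf k hk
  fun_prop

/-- The function `v ↦ v f'(x v)`, which is `x⁻¹ (T f)(x v)` for `x ≠ 0`. -/
theorem mul_deriv_comp_mul_eq {x : ℝ} (hx : x ≠ 0) (f : ℝ → ℝ) :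
    (fun v => v * deriv f (x * v)) = fun v => x⁻¹ * opT f (x * v) := by
  funext v
  simp only [opT]
  field_simp

/-- One application of `T` is spent in forming `v f'(x v)`; the other `n` pass through the dilation.
This closes the inductions on `n`. -/
theorem inv_mul_opT_iterate_mul_deriv_comp_mul {x : ℝ} (hx : x ≠ 0) (n : ℕ) (f : ℝ → ℝ) (v : ℝ) :
    v⁻¹ * (opT^[n] fun v => v * deriv f (x * v)) v =
      (x * v)⁻¹ * (opT^[n + 1] f) (x * v) := by
  rw [mul_deriv_comp_mul_eq hx, opT_iterate_const_mul_comp_mul, Function.iterate_succ_apply,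
    mul_inv]
  ring

theorem hasDerivAt_mul_comp_mul {f : ℝ → ℝ} (hf : Differentiable ℝ f) (v x : ℝ) :
    HasDerivAt (fun x => v * f (x * v)) (v * (v * deriv f (x * v))) x := by
  have h := ((hf (x * v)).hasDerivAt.comp x ((hasDerivAt_id x).mul_const v)).const_mul v
  refine h.congr_deriv ?_
  ring

theorem measurable_opT (f : ℝ → ℝ) : Measurable (opT f) :=
  measurable_id.mul (measurable_deriv f)

theorem measurable_opT_iterate_succ (n : ℕ) (f : ℝ → ℝ) : Measurable (opT^[n + 1] f) := by
  rw [Function.iterate_succ_apply']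
  exact measurable_opT _

/-! ### Induction on the number of factors -/

section
variable {n : ℕ} {σ : ℝ}

/-- Fubini's theorem for `W = X V`, first over `X`, for a test function after one Stein step. -/
theorem lintegral_mul_productNormal_succ_le {f : ℝ → ℝ} (hf : Differentiable ℝ f) (h0 : f 0 = 0) :
    ∫⁻ w, ‖w * f w‖ₑ ∂(productNormal (n + 1) σ) ≤
      ∫⁻ x, ∫⁻ v, ‖v * (v * deriv f (x * v))‖ₑ ∂(productNormal n σ) ∂(gaussianReal 0 1) := by
  have hm : Measurable fun p : ℝ × ℝ => ‖p.2 * (p.2 * deriv f (p.1 * p.2))‖ₑ :=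
    (measurable_snd.mul (measurable_snd.mul
      ((measurable_deriv f).comp (measurable_fst.mul measurable_snd)))).enorm
  have hmf : Measurable f := hf.continuous.measurable
  rw [productNormal_succ, lintegral_map (by fun_prop) (by fun_prop),
    lintegral_prod_symm _ (by fun_prop)]
  refine LE.le.trans ?_ (lintegral_lintegral_swap hm.aemeasurable).symm.le
  refine lintegral_mono fun v => ?_
  have hd := hasDerivAt_mul_comp_mul hf v
  calc ∫⁻ x, ‖x * v * f (x * v)‖ₑ ∂(gaussianReal 0 1)
      = ∫⁻ x, ‖x * (v * f (x * v))‖ₑ ∂(gaussianReal 0 1) := by simp only [mul_assoc]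
    _ ≤ ∫⁻ x, ‖deriv (fun x => v * f (x * v)) x‖ₑ ∂(gaussianReal 0 1) :=
        lintegral_mul_le_lintegral_deriv_gaussianReal (fun x => (hd x).differentiableAt)
          (by simp [h0])
    _ = _ := by simp only [(hd _).deriv]

theorem lintegral_lintegral_productNormal_succ {g : ℝ → ENNReal} (hg : Measurable g) :
    ∫⁻ x, ∫⁻ v, g (x * v) ∂(productNormal n σ) ∂(gaussianReal 0 1) =
      ∫⁻ w, g w ∂(productNormal (n + 1) σ) := by
  rw [productNormal_succ, lintegral_map hg (by fun_prop), lintegral_prod _ (by fun_prop)]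

/-- The Gaussian inequality is used in `x` at fixed `v`, then the induction hypothesis in `v` at
fixed `x`. The condition at 0 is inherited because `v f'(x v)` vanishes at `v = 0`. -/
theorem lintegral_mul_productNormal_le (hσ : σ ≠ 0) {f : ℝ → ℝ} (hf : IteratesDifferentiable n f)
    (hm : Measurable f) (h0 : f 0 = 0) :
    ∫⁻ w, ‖w * f w‖ₑ ∂(productNormal n σ) ≤
      ‖σ ^ 2‖ₑ * ∫⁻ w, ‖w⁻¹ * (opT^[n] f) w‖ₑ ∂(productNormal n σ) := by
  induction n generalizing f with
  | zero =>
    rw [productNormal_zero, lintegral_dirac, lintegral_dirac, ← enorm_mul]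
    refine le_of_eq (congrArg _ ?_)
    simp only [Function.iterate_zero, id]
    field_simp
  | succ n ih =>
    have hT := measurable_opT_iterate_succ n f
    refine (lintegral_mul_productNormal_succ_le hf.differentiable h0).trans ?_
    rw [← lintegral_lintegral_productNormal_succ (by fun_prop),
      ← lintegral_const_mul' _ _ (by simp)]
    refine lintegral_mono_ae ?_
    filter_upwards [ae_gaussianReal_ne_zero] with x hx
    have hg : IteratesDifferentiable n fun v => v * deriv f (x * v) := by
      rw [mul_deriv_comp_mul_eq hx]
      exact hf.opT.const_mul_comp_mul _ _
    refine (ih hg (measurable_id.mul ((measurable_deriv f).comp (measurable_const_mul x)))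
      (by simp)).trans_eq ?_
    simp only [inv_mul_opT_iterate_mul_deriv_comp_mul hx]

theorem integrable_mul_productNormal (hσ : σ ≠ 0) {f : ℝ → ℝ} (hf : IteratesDifferentiable n f)
    (hm : Measurable f) (h0 : f 0 = 0)
    (hi : Integrable (fun w => w⁻¹ * (opT^[n] f) w) (productNormal n σ)) :
    Integrable (fun w => w * f w) (productNormal n σ) :=
  ⟨(measurable_id.mul hm).aestronglyMeasurable,
    (lintegral_mul_productNormal_le hσ hf hm h0).trans_lt
      (ENNReal.mul_lt_top (by simp) hi.2)⟩

theorem integral_mul_productNormal (hσ : σ ≠ 0) {f : ℝ → ℝ} (hf : IteratesDifferentiable n f)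
    (hm : Measurable f) (h0 : f 0 = 0)
    (hi : Integrable (fun w => w⁻¹ * (opT^[n] f) w) (productNormal n σ)) :
    ∫ w, w * f w ∂(productNormal n σ) =
      σ ^ 2 * ∫ w, w⁻¹ * (opT^[n] f) w ∂(productNormal n σ) := by
  induction n generalizing f with
  | zero =>
    rw [productNormal_zero, integral_dirac, integral_dirac]
    simp only [Function.iterate_zero, id]
    field_simp
  | succ n ih =>
    have hT := measurable_opT_iterate_succ n f
    have hg : ∀ x ≠ 0, IteratesDifferentiable n fun v => v * deriv f (x * v) := fun x hx => by
      rw [mul_deriv_comp_mul_eq hx]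
      exact hf.opT.const_mul_comp_mul _ _
    have hgm : ∀ x, Measurable fun v => v * deriv f (x * v) := fun x =>
      measurable_id.mul ((measurable_deriv f).comp (measurable_const_mul x))
    have hwf := integrable_mul_productNormal hσ hf hm h0 hi
    have hm2 : Measurable fun p : ℝ × ℝ => p.2 * (p.2 * deriv f (p.1 * p.2)) :=
      measurable_snd.mul (measurable_snd.mul
        ((measurable_deriv f).comp (measurable_fst.mul measurable_snd)))
    -- Joint integrability of the intermediate integrand, from the inequality for `n` factors. It
    -- justifies both the Gaussian identity on almost every slice and the exchange of integrals.
    have hmid : Integrable (fun p : ℝ × ℝ => p.2 * (p.2 * deriv f (p.1 * p.2)))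
        ((gaussianReal 0 1).prod (productNormal n σ)) := by
      refine ⟨hm2.aestronglyMeasurable, ?_⟩
      have : ∫⁻ x, ∫⁻ v, ‖v * (v * deriv f (x * v))‖ₑ ∂(productNormal n σ) ∂(gaussianReal 0 1) ≤
          ‖σ ^ 2‖ₑ * ∫⁻ w, ‖w⁻¹ * (opT^[n + 1] f) w‖ₑ ∂(productNormal (n + 1) σ) := by
        rw [← lintegral_lintegral_productNormal_succ (by fun_prop),
          ← lintegral_const_mul' _ _ (by simp)]
        refine lintegral_mono_ae ?_
        filter_upwards [ae_gaussianReal_ne_zero] with x hx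
        refine (lintegral_mul_productNormal_le hσ (hg x hx) (hgm x) (by simp)).trans_eq ?_
        simp only [inv_mul_opT_iterate_mul_deriv_comp_mul hx]
      rw [hasFiniteIntegral_iff_enorm, lintegral_prod _ (by fun_prop)]
      exact this.trans_lt (ENNReal.mul_lt_top (by simp) hi.2)
    rw [productNormal_succ] at hi hwf ⊢
    rw [integrable_map_measure (by fun_prop) (by fun_prop)] at hi hwf
    rw [integral_map (by fun_prop) (by fun_prop), integral_map (by fun_prop) (by fun_prop)]
    simp only [Function.comp_def] at hi hwf
    rw [integral_prod_symm _ hwf, integral_prod _ hi]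
    calc ∫ v, ∫ x, x * v * f (x * v) ∂(gaussianReal 0 1) ∂(productNormal n σ)
        = ∫ v, ∫ x, v * (v * deriv f (x * v)) ∂(gaussianReal 0 1) ∂(productNormal n σ) := by
          refine integral_congr_ae ?_
          filter_upwards [hmid.prod_left_ae] with v hv
          have hd := hasDerivAt_mul_comp_mul hf.differentiable v
          have hd' : deriv (fun x => v * f (x * v)) = fun x => v * (v * deriv f (x * v)) :=
            funext fun x => (hd x).deriv
          have h := integral_mul_eq_integral_deriv_gaussianReal
            (fun x => (hd x).differentiableAt) (by simp [h0]) (by rw [hd']; exact hv)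
          rw [hd'] at h
          rw [← h]
          simp only [mul_assoc]
      _ = ∫ x, ∫ v, v * (v * deriv f (x * v)) ∂(productNormal n σ) ∂(gaussianReal 0 1) :=
          (integral_integral_swap hmid).symm
      _ = _ := by
          rw [← integral_const_mul]
          refine integral_congr_ae ?_
          filter_upwards [ae_gaussianReal_ne_zero, hi.prod_right_ae] with x hx hix
          refine (ih (hg x hx) (hgm x) (by simp) ?_).trans ?_
          · simpa only [inv_mul_opT_iterate_mul_deriv_comp_mul hx] using hix
          · simp only [inv_mul_opT_iterate_mul_deriv_comp_mul hx]

end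

/-! ### Iterates of `T` in terms of ordinary derivatives -/

theorem opT_const_mul (c : ℝ) (f : ℝ → ℝ) : opT (fun x => c * f x) = fun x => c * opT f x := by
  simpa using opT_const_mul_comp_mul c 1 f

theorem opT_add {f g : ℝ → ℝ} (hf : Differentiable ℝ f) (hg : Differentiable ℝ g) :
    opT (f + g) = opT f + opT g := by
  funext x
  simp only [opT, deriv_add (hf x) (hg x), Pi.add_apply]
  ring

/-- The span of the functions `x ↦ xᵏ f⁽ᵏ⁾(x)` for `1 ≤ k ≤ j`. -/
def eulerSpan (f : ℝ → ℝ) (j : ℕ) : Submodule ℝ (ℝ → ℝ) :=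
  Submodule.span ℝ ((fun k x => x ^ k * iteratedDeriv k f x) '' Set.Icc 1 j)

theorem pow_mul_iteratedDeriv_mem_eulerSpan (f : ℝ → ℝ) {j k : ℕ} (h1 : 1 ≤ k) (hk : k ≤ j) :
    (fun x => x ^ k * iteratedDeriv k f x) ∈ eulerSpan f j :=
  Submodule.subset_span ⟨k, ⟨h1, hk⟩, rfl⟩

/-- On generators, `T(xᵏ f⁽ᵏ⁾) = k xᵏ f⁽ᵏ⁾ + xᵏ⁺¹ f⁽ᵏ⁺¹⁾`. Both claims are proved together because
additivity of `T` requires differentiability. -/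
theorem differentiable_and_opT_mem_eulerSpan {n : ℕ} {f : ℝ → ℝ} (hf : TimesDifferentiable n f)
    {j : ℕ} (hj : j < n) {g : ℝ → ℝ} (hg : g ∈ eulerSpan f j) :
    Differentiable ℝ g ∧ opT g ∈ eulerSpan f (j + 1) := by
  induction hg using Submodule.span_induction with
  | mem g hg =>
    obtain ⟨k, ⟨hk1, hkj⟩, rfl⟩ := hg
    have hd := hf k (hkj.trans_lt hj)
    refine ⟨by fun_prop, ?_⟩
    have h : opT (fun x => x ^ k * iteratedDeriv k f x) =
        (k : ℝ) • (fun x => x ^ k * iteratedDeriv k f x) +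
          fun x => x ^ (k + 1) * iteratedDeriv (k + 1) f x := by
      funext x
      obtain ⟨m, rfl⟩ : ∃ m, k = m + 1 := ⟨k - 1, by omega⟩
      simp only [opT, deriv_fun_mul (differentiableAt_pow (m + 1) (x := x)) (hd x),
        Pi.add_apply, Pi.smul_apply, smul_eq_mul, iteratedDeriv_succ (n := m + 1),
        deriv_pow_field, Nat.add_sub_cancel]
      ring
    simp only at h ⊢
    rw [h]
    exact add_mem (Submodule.smul_mem _ _ (pow_mul_iteratedDeriv_mem_eulerSpan f hk1 (by omega)))
      (pow_mul_iteratedDeriv_mem_eulerSpan f (by omega) (by omega))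
  | zero =>
    refine ⟨differentiable_const 0, ?_⟩
    have : opT (0 : ℝ → ℝ) = 0 := by
      funext x
      simp [opT]
    rw [this]
    exact zero_mem _
  | add g h _ _ ihg ihh =>
    refine ⟨ihg.1.add ihh.1, ?_⟩
    rw [opT_add ihg.1 ihh.1]
    exact add_mem ihg.2 ihh.2
  | smul c g _ ih =>
    refine ⟨ih.1.const_smul c, ?_⟩
    have := opT_const_mul c g
    rw [show c • g = fun x => c * g x from rfl, this]
    exact Submodule.smul_mem _ c ih.2

theorem opT_iterate_succ_mem_eulerSpan {n : ℕ} {f : ℝ → ℝ} (hf : TimesDifferentiable n f) {j : ℕ}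
    (hj : j < n) : opT^[j + 1] f ∈ eulerSpan f (j + 1) := by
  induction j with
  | zero =>
    have h := pow_mul_iteratedDeriv_mem_eulerSpan f (j := 1) le_rfl le_rfl
    simp only [pow_one, iteratedDeriv_one] at h
    exact h
  | succ j ih =>
    rw [Function.iterate_succ_apply']
    exact (differentiable_and_opT_mem_eulerSpan hf hj (ih (by omega))).2

theorem TimesDifferentiable.iteratesDifferentiable {n : ℕ} {f : ℝ → ℝ}
    (hf : TimesDifferentiable n f) : IteratesDifferentiable n f := fun k hk => by
  cases k with
  | zero => simpa using hf 0 hk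
  | succ k =>
    exact (differentiable_and_opT_mem_eulerSpan hf hk
      (opT_iterate_succ_mem_eulerSpan hf (by omega))).1

/-- The expansion of `Tⁿ f` has no term with `k = 0`, so dividing by `x` leaves exactly the
functions `xᵏ⁻¹ f⁽ᵏ⁾`. -/
theorem integrable_opA_of_forall_integrable {n : ℕ} (hn : 1 ≤ n) {μ : Measure ℝ}
    (hμ : ∀ᵐ x ∂μ, x ≠ 0) {f : ℝ → ℝ} (hf : TimesDifferentiable n f)
    (hi : ∀ k ∈ Finset.Icc 1 n, Integrable (fun x => x ^ (k - 1) * iteratedDeriv k f x) μ) :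
    Integrable (opA n f) μ := by
  have key : ∀ g ∈ eulerSpan f n, Integrable (fun x => x⁻¹ * g x) μ := fun g hg => by
    induction hg using Submodule.span_induction with
    | mem g hg =>
      obtain ⟨k, hk, rfl⟩ := hg
      refine (hi k (Finset.mem_Icc.2 hk)).congr ?_
      filter_upwards [hμ] with x hx
      obtain ⟨m, rfl⟩ : ∃ m, k = m + 1 := ⟨k - 1, by have := hk.1; omega⟩
      simp only [Nat.add_sub_cancel]
      field_simp
      ring
    | zero => simp
    | add g h _ _ ihg ihh =>
      refine (ihg.add ihh).congr (.of_forall fun x => ?_)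
      simp only [Pi.add_apply]
      ring
    | smul c g _ ih =>
      refine (ih.const_mul c).congr (.of_forall fun x => ?_)
      simp only [Pi.smul_apply, smul_eq_mul]
      ring
  obtain ⟨m, rfl⟩ : ∃ m, n = m + 1 := ⟨n - 1, by omega⟩
  refine (key _ (opT_iterate_succ_mem_eulerSpan hf m.lt_succ_self)).congr ?_
  filter_upwards [hμ] with x hx
  exact (opA_eq_inv_mul hn f hx).symm

/-- An eigenfunction of `T`. -/
theorem opT_iterate_of_eigen {f : ℝ → ℝ} {s : ℝ} (h : opT f = fun x => s * f x) (k : ℕ) :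
    opT^[k] f = fun x => s ^ k * f x := by
  induction k with
  | zero => simp
  | succ k ih =>
    rw [Function.iterate_succ_apply', ih, opT_const_mul, h]
    funext x
    ring

theorem opA_of_eigen {f : ℝ → ℝ} {s : ℝ} (h : opT f = fun x => s * f x) (n : ℕ) :
    opA n f = fun x => s ^ (n - 1) * deriv f x := by
  rw [opA, opT_iterate_of_eigen h]
  funext x
  simp

theorem opT_pow (m : ℕ) : opT (fun x : ℝ => x ^ m) = fun x => (m : ℝ) * x ^ m := by
  funext x
  cases m with
  | zero => simp [opT]
  | succ m =>
    simp only [opT, deriv_pow_field, Nat.add_sub_cancel]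
    ring

theorem timesDifferentiable_of_contDiff {n : ℕ} {f : ℝ → ℝ} (hf : ContDiff ℝ n f) :
    TimesDifferentiable n f := fun k hk =>
  hf.differentiable_iteratedDeriv k (by exact_mod_cast hk)

theorem opT_sub_const (f : ℝ → ℝ) (c : ℝ) : opT (fun x => f x - c) = opT f := by
  funext x
  simp [opT]

theorem opA_sub_const (n : ℕ) (f : ℝ → ℝ) (c : ℝ) : opA n (fun x => f x - c) = opA n f := by
  unfold opA
  cases n - 1 with
  | zero =>
    funext x
    simp
  | succ n => rw [Function.iterate_succ_apply, opT_sub_const, ← Function.iterate_succ_apply]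

/-! ### Stein's identity and moments of the product normal law -/

section
variable {n : ℕ} {σ : ℝ}

theorem opA_ae_eq_productNormal (hn : 1 ≤ n) (hσ : σ ≠ 0) (f : ℝ → ℝ) :
    opA n f =ᵐ[productNormal n σ] fun x => x⁻¹ * (opT^[n] f) x := by
  filter_upwards [ae_productNormal_ne_zero n hσ] with x hx
  exact opA_eq_inv_mul hn f hx

theorem stein_productNormal_of_zero (hn : 1 ≤ n) (hσ : σ ≠ 0) {f : ℝ → ℝ}
    (hf : IteratesDifferentiable n f) (h0 : f 0 = 0)
    (hi : Integrable (opA n f) (productNormal n σ)) :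
    Integrable (fun x => x * f x) (productNormal n σ) ∧
      ∫ x, x * f x ∂(productNormal n σ) = σ ^ 2 * ∫ x, opA n f x ∂(productNormal n σ) := by
  have hm : Measurable f := (hf 0 hn).continuous.measurable
  have he := opA_ae_eq_productNormal hn hσ f
  rw [integrable_congr he] at hi
  rw [integral_congr_ae he]
  exact ⟨integrable_mul_productNormal hσ hf hm h0 hi, integral_mul_productNormal hσ hf hm h0 hi⟩

theorem iteratesDifferentiable_pow (m : ℕ) : IteratesDifferentiable n fun x : ℝ => x ^ m :=
  (timesDifferentiable_of_contDiff (by fun_prop)).iteratesDifferentiable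

/-- For `f = x²ᵏ⁺¹`, `Aₙ f` is a multiple of `x²ᵏ` and `x f` is the next even power, so
integrability climbs by Stein's identity. -/
theorem integrable_pow_productNormal (hn : 1 ≤ n) (hσ : σ ≠ 0) (k : ℕ) :
    Integrable (fun x => x ^ (2 * k)) (productNormal n σ) := by
  induction k with
  | zero => simp
  | succ k ih =>
    have h := (stein_productNormal_of_zero hn hσ (iteratesDifferentiable_pow (2 * k + 1))
      (by simp) ?_).1
    · refine h.congr (.of_forall fun x => ?_)
      simp only
      ring
    · rw [opA_of_eigen (opT_pow _)]
      refine (ih.const_mul (((2 * k + 1 : ℕ) : ℝ) ^ (n - 1) * (2 * k + 1 : ℕ))).congr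
        (.of_forall fun x => ?_)
      simp only [deriv_pow_field, Nat.add_sub_cancel]
      ring

theorem integral_sq_productNormal (hn : 1 ≤ n) (hσ : σ ≠ 0) :
    ∫ x, x ^ 2 ∂(productNormal n σ) = σ ^ 2 := by
  have he : opA n (fun x : ℝ => x ^ 1) = fun _ => 1 := by
    rw [opA_of_eigen (opT_pow 1)]
    simp
  have h := (stein_productNormal_of_zero hn hσ (iteratesDifferentiable_pow 1)
      (by simp) (by rw [he]; exact integrable_const 1)).2
  rw [he] at h
  simpa [sq] using h

theorem memLp_two_productNormal (hn : 1 ≤ n) (hσ : σ ≠ 0) :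
    MemLp (fun x : ℝ => x) 2 (productNormal n σ) :=
  (memLp_two_iff_integrable_sq measurable_id.aestronglyMeasurable).2
    (integrable_pow_productNormal hn hσ 1)

theorem integral_id_productNormal (hn : 1 ≤ n) : ∫ x, x ∂(productNormal n σ) = 0 := by
  obtain ⟨m, rfl⟩ : ∃ m, n = m + 1 := ⟨n - 1, by omega⟩
  rw [productNormal_succ, integral_map (by fun_prop) (by fun_prop),
    integral_prod_mul (fun x : ℝ => x) (fun x : ℝ => x), integral_id_gaussianReal, zero_mul]

theorem variance_productNormal (hn : 1 ≤ n) (hσ : σ ≠ 0) :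
    variance (fun x : ℝ => x) (productNormal n σ) = σ ^ 2 := by
  rw [variance_of_integral_eq_zero (by fun_prop) (integral_id_productNormal hn)]
  exact integral_sq_productNormal hn hσ

/-- **Stein's identity** for the product normal law. -/
theorem stein_productNormal (hn : 1 ≤ n) (hσ : σ ≠ 0) {f : ℝ → ℝ}
    (hf : IteratesDifferentiable n f) (hi : Integrable (opA n f) (productNormal n σ)) :
    Integrable (fun x => x * f x) (productNormal n σ) ∧
      ∫ x, x * f x ∂(productNormal n σ) = σ ^ 2 * ∫ x, opA n f x ∂(productNormal n σ) := by
  have hx : Integrable (fun x : ℝ => x) (productNormal n σ) :=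
    (memLp_two_productNormal hn hσ).integrable one_le_two
  have hxc := hx.mul_const (f 0)
  -- Subtracting `f 0` leaves `Aₙ f` alone and changes `E[W f(W)]` by a multiple of the mean, which
  -- is zero.
  have hg : IteratesDifferentiable n fun x => f x - f 0 := fun k hk => by
    cases k with
    | zero => exact (hf 0 hk).sub_const _
    | succ k =>
      rw [Function.iterate_succ_apply, opT_sub_const, ← Function.iterate_succ_apply]
      exact hf _ hk
  have h := stein_productNormal_of_zero hn hσ hg (sub_self _) (by rwa [opA_sub_const])
  rw [opA_sub_const] at h
  have he : (fun x => x * f x) = fun x => x * (f x - f 0) + x * f 0 := by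
    funext x
    ring
  rw [he]
  refine ⟨h.1.add hxc, ?_⟩
  rw [integral_add h.1 hxc, h.2, integral_mul_const, integral_id_productNormal hn, zero_mul,
    add_zero]

end

/-! ### A Bohr–Mollerup uniqueness argument -/

/-- By convexity the slope over `[s+2, t+2]` lies between those over `[s, s+2]` and `[s+2, s+4]`,
namely `φ s / 2` and `φ (s+2) / 2`. Both functions obey this same sandwich, and `(t - s) / 2 < 1`.
-/
theorem ConvexOn.abs_sub_sub_sub_le {g h : ℝ → ℝ} {a : ℝ} (hg : ConvexOn ℝ (Set.Ioi a) g)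
    (hh : ConvexOn ℝ (Set.Ioi a) h) {φ : ℝ → ℝ}
    (hgφ : ∀ s > a, g (s + 2) = g s + φ s) (hhφ : ∀ s > a, h (s + 2) = h s + φ s)
    {s t : ℝ} (hs : a < s) (hst : s < t) (hts : t < s + 2) :
    |(g (t + 2) - h (t + 2)) - (g (s + 2) - h (s + 2))| ≤ φ (s + 2) - φ s := by
  have key : ∀ f : ℝ → ℝ, ConvexOn ℝ (Set.Ioi a) f → (∀ s > a, f (s + 2) = f s + φ s) →
      (t - s) / 2 * φ s ≤ f (t + 2) - f (s + 2) ∧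
        f (t + 2) - f (s + 2) ≤ (t - s) / 2 * φ (s + 2) := fun f hf hfφ => by
    have h1 := hf.slope_mono_adjacent (x := s) (y := s + 2) (z := t + 2)
      (Set.mem_Ioi.2 hs) (Set.mem_Ioi.2 (by linarith)) (by linarith) (by linarith)
    have h2 := hf.secant_mono (a := s + 2) (x := t + 2) (y := s + 2 + 2)
      (Set.mem_Ioi.2 (by linarith)) (Set.mem_Ioi.2 (by linarith)) (Set.mem_Ioi.2 (by linarith))
      (by linarith) (by linarith) (by linarith)
    have e1 := hfφ s hs
    have e2 := hfφ (s + 2) (by linarith)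
    have e3 : t + 2 - (s + 2) = t - s := by ring
    have e4 : s + 2 + 2 - (s + 2) = 2 := by ring
    have hpos : 0 < t - s := by linarith
    rw [e3] at h1 h2
    rw [e4, e2, add_sub_cancel_left, div_le_iff₀ hpos] at h2
    rw [e1, add_sub_cancel_left, add_sub_cancel_left, le_div_iff₀ hpos] at h1
    constructor
    · rw [e1]; linarith
    · linarith
  obtain ⟨g1, g2⟩ := key g hg hgφ
  obtain ⟨h1, h2⟩ := key h hh hhφ
  have hφ : (t - s) / 2 * φ s ≤ (t - s) / 2 * φ (s + 2) := g1.trans g2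
  have hφ' : φ s ≤ φ (s + 2) := le_of_mul_le_mul_left hφ (by linarith)
  have h3 : (t - s) / 2 * (φ (s + 2) - φ s) ≤ 1 * (φ (s + 2) - φ s) :=
    mul_le_mul_of_nonneg_right (by linarith) (by linarith)
  rw [abs_le]
  constructor <;> linarith

/-- A uniqueness theorem of Bohr–Mollerup type: two convex solutions of the same difference
equation whose right-hand side has vanishing increments differ by a constant. -/
theorem ConvexOn.sub_eq_sub_of_difference_eq {g h : ℝ → ℝ} {a : ℝ}
    (hg : ConvexOn ℝ (Set.Ioi a) g) (hh : ConvexOn ℝ (Set.Ioi a) h) {φ : ℝ → ℝ}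
    (hgφ : ∀ s > a, g (s + 2) = g s + φ s) (hhφ : ∀ s > a, h (s + 2) = h s + φ s)
    (hφ : Filter.Tendsto (fun s => φ (s + 2) - φ s) Filter.atTop (nhds 0))
    {s t : ℝ} (hs : a < s) (ht : a < t) : g s - h s = g t - h t := by
  -- The difference has period 2, so it may be compared arbitrarily far out, where the previous
  -- bound tends to zero.
  have hper : ∀ s > a, ∀ m : ℕ, g (s + 2 * m) - h (s + 2 * m) = g s - h s := fun s hs m => by
    induction m with
    | zero => simp
    | succ m ih =>
      have hm : a < s + 2 * m := by
        have : (0 : ℝ) ≤ m := m.cast_nonneg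
        linarith
      have e : s + 2 * ((m + 1 : ℕ) : ℝ) = s + 2 * m + 2 := by push_cast; ring
      rw [e, hgφ _ hm, hhφ _ hm, ← ih]
      ring
  have hnear : ∀ s > a, ∀ t, s < t → t < s + 2 → g t - h t = g s - h s := fun s hs t hst hts => by
    have hlim : Filter.Tendsto (fun m : ℕ => φ (s + 2 * m + 2) - φ (s + 2 * m)) Filter.atTop
        (nhds 0) := hφ.comp (Filter.tendsto_atTop_add_const_left _ s
          (tendsto_natCast_atTop_atTop.const_mul_atTop two_pos))
    have hle : |(g t - h t) - (g s - h s)| ≤ 0 := by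
      refine ge_of_tendsto' hlim fun m => ?_
      have hm : (0 : ℝ) ≤ m := m.cast_nonneg
      have := hg.abs_sub_sub_sub_le hh hgφ hhφ (s := s + 2 * m) (t := t + 2 * m)
        (by linarith) (by linarith) (by linarith)
      have e : ∀ u : ℝ, u + 2 * (m : ℝ) + 2 = u + 2 * ((m + 1 : ℕ) : ℝ) := fun u => by
        push_cast; ring
      rw [e t, e s, hper t (hs.trans hst), hper s hs, ← e s] at this
      exact this
    exact sub_eq_zero.1 (abs_nonpos_iff.1 hle)
  wlog hst : s ≤ t generalizing s t
  · exact (this ht hs (le_of_not_ge hst)).symm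
  set m := ⌊(t - s) / 2⌋₊
  have h1 := Nat.floor_le (a := (t - s) / 2) (by linarith)
  have h2 := Nat.lt_floor_add_one ((t - s) / 2)
  change (m : ℝ) ≤ _ at h1
  change _ < (m : ℝ) + 1 at h2
  have e : t = (t - 2 * m) + 2 * m := by ring
  have h3 : a < t - 2 * m := by linarith
  rw [e, hper _ h3]
  rcases eq_or_lt_of_le (show s ≤ t - 2 * m by linarith) with h | h
  · rw [← h]
  · exact (hnear s hs _ h (by linarith)).symm

/-! ### Determination of a measure by its moment generating function -/

theorem convexOn_cgf {Ω : Type*} [MeasurableSpace Ω] {X : Ω → ℝ} {μ : Measure Ω} {a : ℝ}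
    (h : Set.Ioi a ⊆ interior (integrableExpSet X μ)) :
    ConvexOn ℝ (Set.Ioi a) (cgf X μ) := by
  have ha : AnalyticOnNhd ℝ (cgf X μ) (Set.Ioi a) := analyticOnNhd_cgf.mono h
  refine convexOn_of_deriv2_nonneg (convex_Ioi a) ha.continuousOn ?_ ?_ ?_
  · rw [interior_Ioi]
    exact ha.differentiableOn
  · rw [interior_Ioi]
    exact ha.deriv.differentiableOn
  · intro x hx
    rw [interior_Ioi] at hx
    rw [← iteratedDeriv_eq_iterate, iteratedDeriv_two_cgf_eq_integral (h hx)]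
    exact div_nonneg (integral_nonneg fun _ => by positivity) mgf_nonneg

theorem Ioi_subset_interior_integrableExpSet {Ω : Type*} [MeasurableSpace Ω] {X : Ω → ℝ}
    {μ : Measure Ω} {a : ℝ} (h : ∀ t > a, Integrable (fun ω => Real.exp (t * X ω)) μ) :
    Set.Ioi a ⊆ interior (integrableExpSet X μ) :=
  interior_maximal (fun t ht => h t ht) isOpen_Ioi

/-- Logarithms turn the hypotheses into one difference equation for two convex functions; the ratio
limit says that `log φ` has vanishing increments. -/
theorem exists_mgf_eq_mul_of_difference_eq {ρ ρ' : Measure ℝ} [NeZero ρ] [NeZero ρ'] {a : ℝ}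
    (hi : ∀ t > a, Integrable (fun x => Real.exp (t * x)) ρ)
    (hi' : ∀ t > a, Integrable (fun x => Real.exp (t * x)) ρ')
    {φ : ℝ → ℝ} (hφ0 : ∀ t > a, 0 < φ t)
    (hφ : Filter.Tendsto (fun s => φ (s + 2) / φ s) Filter.atTop (nhds 1))
    (h : ∀ t > a, mgf id ρ (t + 2) = φ t * mgf id ρ t)
    (h' : ∀ t > a, mgf id ρ' (t + 2) = φ t * mgf id ρ' t) :
    ∃ C : NNReal, ∀ t > a, mgf id ρ t = C * mgf id ρ' t := by
  have hpos : ∀ t > a, 0 < mgf id ρ t := fun t ht => mgf_pos' (NeZero.ne ρ) (hi t ht)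
  have hpos' : ∀ t > a, 0 < mgf id ρ' t := fun t ht => mgf_pos' (NeZero.ne ρ') (hi' t ht)
  have hc := convexOn_cgf (Ioi_subset_interior_integrableExpSet (X := id) hi)
  have hc' := convexOn_cgf (Ioi_subset_interior_integrableExpSet (X := id) hi')
  have hlim : Filter.Tendsto (fun s => Real.log (φ (s + 2)) - Real.log (φ s)) Filter.atTop
      (nhds 0) := by
    have h1 := hφ.log one_ne_zero
    rw [Real.log_one] at h1
    refine h1.congr' ?_
    filter_upwards [Filter.eventually_gt_atTop a] with s hs
    exact Real.log_div (hφ0 _ (by linarith)).ne' (hφ0 s hs).ne'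
  have key := fun {s t : ℝ} => hc.sub_eq_sub_of_difference_eq hc' (φ := fun t => Real.log (φ t))
    (fun s hs => by
      simp only [cgf]
      rw [h s hs, Real.log_mul (hφ0 s hs).ne' (hpos s hs).ne', add_comm])
    (fun s hs => by
      simp only [cgf]
      rw [h' s hs, Real.log_mul (hφ0 s hs).ne' (hpos' s hs).ne', add_comm]) hlim (s := s) (t := t)
  refine ⟨(Real.exp (cgf id ρ (a + 1) - cgf id ρ' (a + 1))).toNNReal, fun t ht => ?_⟩
  have := key ht (show a < a + 1 by linarith)
  rw [Real.coe_toNNReal _ (Real.exp_pos _).le, ← this, Real.exp_sub, cgf, cgf,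
    Real.exp_log (hpos t ht), Real.exp_log (hpos' t ht), div_mul_cancel₀ _ (hpos' t ht).ne']

/-- The identity theorem extends the equality to the right half-plane. Exponential moments may fail
to its left, so the imaginary axis, where the characteristic function lives, is reached only as a
boundary limit. -/
theorem Measure.ext_of_mgf_eqOn_Ioi {ρ ρ' : Measure ℝ} [IsFiniteMeasure ρ] [IsFiniteMeasure ρ']
    {a : ℝ} (hi : ∀ t > 0, Integrable (fun x => Real.exp (t * x)) ρ)
    (hi' : ∀ t > 0, Integrable (fun x => Real.exp (t * x)) ρ')
    (h : ∀ t > a, mgf id ρ t = mgf id ρ' t) : ρ = ρ' := by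
  have hs := Ioi_subset_interior_integrableExpSet (X := id) hi
  have hs' := Ioi_subset_interior_integrableExpSet (X := id) hi'
  set U : Set ℂ := {z | z.re ∈ Set.Ioi (0 : ℝ)}
  have hX : AnalyticOnNhd ℂ (complexMGF id ρ) U := analyticOnNhd_complexMGF.mono fun z hz => hs hz
  have hY : AnalyticOnNhd ℂ (complexMGF id ρ') U :=
    analyticOnNhd_complexMGF.mono fun z hz => hs' hz
  set b : ℝ := max a 0 + 1
  have hab : a < b := (le_max_left a 0).trans_lt (lt_add_one _)
  have h0b : 0 < b := (le_max_right a 0).trans_lt (lt_add_one _)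
  have hEq : Set.EqOn (complexMGF id ρ) (complexMGF id ρ') U := by
    refine AnalyticOnNhd.eqOn_of_preconnected_of_frequently_eq hX hY
      ((convex_Ioi (0 : ℝ)).linear_preimage Complex.reLm).isPreconnected
      (z₀ := (b : ℂ)) (by simpa [U] using h0b) ?_
    have h_real : ∃ᶠ x : ℝ in nhdsWithin b {b}ᶜ, complexMGF id ρ x = complexMGF id ρ' x := by
      refine Filter.Eventually.frequently ?_
      filter_upwards [nhdsWithin_le_nhds (Ioi_mem_nhds hab)] with x hx
      rw [complexMGF_ofReal, complexMGF_ofReal, h x hx]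
    rw [Filter.frequently_iff_seq_forall] at h_real ⊢
    obtain ⟨xs, hx_tendsto, hx_eq⟩ := h_real
    refine ⟨fun n => xs n, ?_, hx_eq⟩
    rw [tendsto_nhdsWithin_iff] at hx_tendsto ⊢
    exact ⟨Complex.continuous_ofReal.continuousAt.tendsto.comp hx_tendsto.1,
      by simpa using hx_tendsto.2⟩
  have hlim : ∀ (ρ : Measure ℝ) [IsFiniteMeasure ρ],
      (∀ t > 0, Integrable (fun x => Real.exp (t * x)) ρ) → ∀ y : ℝ,
      Filter.Tendsto (fun m : ℕ => complexMGF id ρ ((1 / ((m : ℝ) + 1) : ℝ) + y * Complex.I))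
        Filter.atTop (nhds (complexMGF id ρ (y * Complex.I))) := fun ρ _ hi y => by
    -- For `0 < r ≤ 1`, `exp(r x)` is at most 1 when `x ≤ 0` and at most `exp x` when `x ≥ 0`.
    refine tendsto_integral_of_dominated_convergence (fun x => 1 + Real.exp (1 * x))
      (fun m => by fun_prop) ((integrable_const 1).add (hi 1 one_pos)) (fun m => ?_) ?_
    · refine .of_forall fun x => ?_
      have hm : 0 < 1 / ((m : ℝ) + 1) := Nat.one_div_pos_of_nat
      have hm1 : 1 / ((m : ℝ) + 1) ≤ 1 := by
        rw [div_le_one (by positivity)]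
        linarith [m.cast_nonneg (α := ℝ)]
      rw [Complex.norm_exp]
      have e : (((1 / ((m : ℝ) + 1) : ℝ) + y * Complex.I) * (id x : ℝ)).re =
          1 / ((m : ℝ) + 1) * x := by
        simp only [Complex.re_mul_ofReal, Complex.add_re, Complex.ofReal_re, Complex.mul_I_re,
          Complex.ofReal_im, neg_zero, add_zero, id]
      rw [e]
      rcases le_total x 0 with hx | hx
      · have : Real.exp (1 / ((m : ℝ) + 1) * x) ≤ 1 :=
          Real.exp_le_one_iff.2 (mul_nonpos_of_nonneg_of_nonpos hm.le hx)
        linarith [Real.exp_pos (1 * x)]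
      · have : Real.exp (1 / ((m : ℝ) + 1) * x) ≤ Real.exp (1 * x) :=
          Real.exp_le_exp.2 (mul_le_mul_of_nonneg_right hm1 hx)
        linarith
    · refine .of_forall fun x => ?_
      have h1 : Filter.Tendsto (fun m : ℕ => (((1 / ((m : ℝ) + 1) : ℝ)) : ℂ)) Filter.atTop
          (nhds ((0 : ℝ) : ℂ)) :=
        Complex.continuous_ofReal.continuousAt.tendsto.comp tendsto_one_div_add_atTop_nhds_zero_nat
      have h2 := ((h1.add_const ((y : ℂ) * Complex.I)).mul_const ((id x : ℝ) : ℂ)).cexp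
      simpa using h2
  refine Measure.ext_of_charFun (funext fun y => ?_)
  rw [← complexMGF_id_mul_I, ← complexMGF_id_mul_I]
  refine tendsto_nhds_unique ((hlim ρ hi y).congr fun m => hEq ?_) (hlim ρ' hi' y)
  have : (0 : ℝ) < 1 / ((m : ℝ) + 1) := Nat.one_div_pos_of_nat
  simpa only [U, Set.mem_ofPred_eq, Set.mem_Ioi, Complex.add_re, Complex.ofReal_re,
    Complex.mul_I_re, Complex.ofReal_im, neg_zero, add_zero] using this

/-! ### One-sided powers as test functions -/

/-- The truncated power `x₊ˢ`. -/
noncomputable def posPow (s x : ℝ) : ℝ := max x 0 ^ s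

theorem posPow_nonneg (s x : ℝ) : 0 ≤ posPow s x := Real.rpow_nonneg (le_max_right _ _) _

theorem posPow_of_pos (s : ℝ) {x : ℝ} (hx : 0 < x) : posPow s x = x ^ s := by
  rw [posPow, max_eq_left hx.le]

theorem posPow_of_nonpos {s x : ℝ} (hs : s ≠ 0) (hx : x ≤ 0) : posPow s x = 0 := by
  rw [posPow, max_eq_right hx, Real.zero_rpow hs]

theorem continuous_posPow {s : ℝ} (hs : 0 ≤ s) : Continuous (posPow s) :=
  (continuous_id.max continuous_const).rpow_const fun _ => Or.inr hs

theorem mul_posPow {s : ℝ} (hs : 0 < s) (x : ℝ) : x * posPow s x = posPow (s + 1) x := by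
  rcases le_or_gt x 0 with hx | hx
  · rw [posPow_of_nonpos hs.ne' hx, posPow_of_nonpos (by linarith) hx, mul_zero]
  · rw [posPow_of_pos _ hx, posPow_of_pos _ hx, Real.rpow_add_one hx.ne', mul_comm]

theorem pow_mul_posPow {s : ℝ} (hs : 0 < s) (k : ℕ) (x : ℝ) :
    x ^ k * posPow s x = posPow (s + k) x := by
  induction k with
  | zero => simp
  | succ k ih =>
    rw [pow_succ', mul_assoc, ih, mul_posPow (by positivity)]
    push_cast
    ring_nf

theorem hasDerivAt_posPow {s : ℝ} (hs : 1 < s) (x : ℝ) :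
    HasDerivAt (posPow s) (s * posPow (s - 1) x) x := by
  have key : ∀ y ≠ 0, HasDerivAt (posPow s) (s * posPow (s - 1) y) y := fun y hy => by
    rcases lt_or_gt_of_ne hy with hy | hy
    · rw [posPow_of_nonpos (by linarith) hy.le, mul_zero]
      refine (hasDerivAt_const y (0 : ℝ)).congr_of_eventuallyEq ?_
      filter_upwards [Iio_mem_nhds hy] with z hz
      exact posPow_of_nonpos (by linarith) (le_of_lt hz)
    · rw [posPow_of_pos _ hy]
      refine (Real.hasDerivAt_rpow_const (Or.inl hy.ne')).congr_of_eventuallyEq ?_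
      filter_upwards [Ioi_mem_nhds hy] with z hz
      exact posPow_of_pos _ hz
  rcases eq_or_ne x 0 with rfl | hx
  -- At the kink the derivative is the limit of nearby derivatives, which exists because `s - 1 >
  -- 0`.
  · exact hasDerivAt_of_hasDerivAt_of_ne key (continuous_posPow (by linarith)).continuousAt
      ((continuous_posPow (by linarith)).const_mul s).continuousAt
  · exact key x hx

theorem deriv_posPow {s : ℝ} (hs : 1 < s) : deriv (posPow s) = fun x => s * posPow (s - 1) x :=
  funext fun x => (hasDerivAt_posPow hs x).deriv

theorem contDiff_posPow {n : ℕ} {s : ℝ} (hs : n < s) : ContDiff ℝ n (posPow s) := by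
  induction n generalizing s with
  | zero => exact contDiff_zero.2 (continuous_posPow (by simpa using hs.le))
  | succ n ih =>
    push_cast at hs
    have hs1 : 1 < s := by linarith [n.cast_nonneg (α := ℝ)]
    refine (contDiff_succ_iff_deriv (n := (n : WithTop ℕ∞))).2
      ⟨fun x => (hasDerivAt_posPow hs1 x).differentiableAt, by simp, ?_⟩
    rw [deriv_posPow hs1]
    exact contDiff_const.mul (ih (by linarith))

theorem iteratedDeriv_posPow {k : ℕ} {s : ℝ} (hs : k < s) :
    ∃ c : ℝ, iteratedDeriv k (posPow s) = fun x => c * posPow (s - k) x := by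
  induction k with
  | zero => exact ⟨1, by simp⟩
  | succ k ih =>
    push_cast at hs
    obtain ⟨c, hc⟩ := ih (by linarith)
    refine ⟨c * (s - k), ?_⟩
    have hd : ∀ x, deriv (fun y => c * posPow (s - k) y) x =
        c * ((s - k) * posPow (s - k - 1) x) :=
      fun x => ((hasDerivAt_posPow (by linarith) x).const_mul c).deriv
    rw [iteratedDeriv_succ, hc]
    funext x
    rw [hd, Nat.cast_succ, ← sub_sub, mul_assoc]

theorem posPow_le_one_add_pow {s : ℝ} (hs : 0 < s) {k : ℕ} (hk : s ≤ 2 * k) (x : ℝ) :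
    posPow s x ≤ 1 + x ^ (2 * k) := by
  have hp : 0 ≤ x ^ (2 * k) := by
    rw [pow_mul]
    positivity
  rcases le_or_gt x 0 with hx | hx
  · rw [posPow_of_nonpos hs.ne' hx]
    linarith
  · rw [posPow_of_pos _ hx]
    rcases le_or_gt x 1 with h1 | h1
    · linarith [Real.rpow_le_one hx.le h1 hs.le]
    · have := Real.rpow_le_rpow_of_exponent_le h1.le hk
      rw [← Real.rpow_natCast x (2 * k)]
      push_cast
      linarith

theorem integrable_posPow {μ : Measure ℝ} [IsFiniteMeasure μ]
    (hμ : ∀ k : ℕ, Integrable (fun x => x ^ (2 * k)) μ) {ε : ℝ} (hε : ε * ε = 1) {s : ℝ}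
    (hs : 0 < s) : Integrable (fun x => posPow s (ε * x)) μ := by
  obtain ⟨k, hk⟩ := exists_nat_ge s
  refine ((integrable_const (1 : ℝ)).add (hμ k)).mono'
    ((continuous_posPow hs.le).comp (continuous_const_mul ε)).aestronglyMeasurable
    (.of_forall fun x => ?_)
  rw [Real.norm_of_nonneg (posPow_nonneg _ _)]
  refine (posPow_le_one_add_pow hs (k := k) (by linarith) (ε * x)).trans_eq ?_
  rw [mul_pow, pow_mul ε, sq, hε, one_pow, one_mul]
  rfl

/-- The truncated power `x₊ˢ` for `ε = 1`, and minus its reflection for `ε = -1`. -/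
noncomputable def oneSidedPow (ε s x : ℝ) : ℝ := ε * posPow s (ε * x)

section
variable {ε : ℝ}

theorem contDiff_oneSidedPow (ε : ℝ) {n : ℕ} {s : ℝ} (hs : n < s) :
    ContDiff ℝ n (oneSidedPow ε s) :=
  contDiff_const.mul ((contDiff_posPow hs).comp (contDiff_const.mul contDiff_id))

theorem mul_oneSidedPow (ε : ℝ) {s : ℝ} (hs : 0 < s) (x : ℝ) :
    x * oneSidedPow ε s x = posPow (s + 1) (ε * x) := by
  rw [oneSidedPow, ← mul_posPow hs]
  ring

theorem deriv_oneSidedPow (hε : ε * ε = 1) {s : ℝ} (hs : 1 < s) (x : ℝ) :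
    deriv (oneSidedPow ε s) x = s * posPow (s - 1) (ε * x) := by
  have h := (((hasDerivAt_posPow hs (ε * x)).comp x ((hasDerivAt_id x).const_mul ε)).const_mul
    ε).deriv
  refine h.trans ?_
  linear_combination s * posPow (s - 1) (ε * x) * hε

/-- Euler's relation for a positively homogeneous function of degree `s`. It reduces Stein's
identity to a recursion between moments. -/
theorem opT_oneSidedPow (hε : ε * ε = 1) {s : ℝ} (hs : 1 < s) :
    opT (oneSidedPow ε s) = fun x => s * oneSidedPow ε s x := by
  funext x
  have h := mul_posPow (s := s - 1) (by linarith) (ε * x)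
  rw [sub_add_cancel] at h
  rw [opT, deriv_oneSidedPow hε hs, oneSidedPow, ← h]
  linear_combination -s * x * posPow (s - 1) (ε * x) * hε

theorem opA_oneSidedPow (hε : ε * ε = 1) {n : ℕ} (hn : 1 ≤ n) {s : ℝ} (hs : 1 < s) :
    opA n (oneSidedPow ε s) = fun x => s ^ n * posPow (s - 1) (ε * x) := by
  obtain ⟨m, rfl⟩ : ∃ m, n = m + 1 := ⟨n - 1, by omega⟩
  rw [opA_of_eigen (opT_oneSidedPow hε hs)]
  funext x
  rw [deriv_oneSidedPow hε hs, Nat.add_sub_cancel]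
  ring

/-- The degree is `s - 1` whatever `k` is, so all the integrability conditions on a test function
reduce to one moment; the constant is irrelevant. -/
theorem pow_mul_iteratedDeriv_oneSidedPow (hε : ε * ε = 1) {k : ℕ} (hk : 1 ≤ k) {s : ℝ}
    (hs : k < s) : ∃ c : ℝ, (fun x => x ^ (k - 1) * iteratedDeriv k (oneSidedPow ε s) x) =
      fun x => c * posPow (s - 1) (ε * x) := by
  obtain ⟨m, rfl⟩ : ∃ m, k = m + 1 := ⟨k - 1, by omega⟩
  obtain ⟨c, hc⟩ := iteratedDeriv_posPow hs
  refine ⟨ε * ε ^ (m + 1) * c * ε ^ m, funext fun x => ?_⟩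
  have h1 : iteratedDeriv (m + 1) (oneSidedPow ε s) x =
      ε * (ε ^ (m + 1) * iteratedDeriv (m + 1) (posPow s) (ε * x)) := by
    have := congrFun (iteratedDeriv_comp_const_mul (contDiff_posPow hs) ε) x
    rw [← this]
    exact iteratedDeriv_const_mul_field ε _
  have h2 := pow_mul_posPow (s := s - (m + 1 : ℕ)) (by linarith) m (ε * x)
  have h3 : s - ((m + 1 : ℕ) : ℝ) + m = s - 1 := by push_cast; ring
  have h4 : ε ^ m * ε ^ m = 1 := by rw [← mul_pow, hε, one_pow]
  rw [h3] at h2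
  rw [h1, hc, ← h2, Nat.add_sub_cancel, mul_pow]
  linear_combination -x ^ m * ε * ε ^ (m + 1) * c * posPow (s - ((m + 1 : ℕ) : ℝ)) (ε * x) * h4

end

/-! ### Mellin transforms of the two halves of a law -/

/-- The law of `ε Z` restricted to `(0, ∞)`, for `Z ∼ μ`. -/
noncomputable def halfLaw (ε : ℝ) (μ : Measure ℝ) : Measure ℝ :=
  (μ.map (ε * ·)).restrict (Set.Ioi 0)

/-- The law of `log (ε Z)` on the event `ε Z > 0`, for `Z ∼ μ`. -/
noncomputable def logHalfLaw (ε : ℝ) (μ : Measure ℝ) : Measure ℝ :=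
  (halfLaw ε μ).map Real.log

section
variable {μ ν : Measure ℝ} {ε : ℝ}

instance [IsFiniteMeasure μ] : IsFiniteMeasure (halfLaw ε μ) := by
  unfold halfLaw
  infer_instance

instance [IsFiniteMeasure μ] : IsFiniteMeasure (logHalfLaw ε μ) := by
  unfold logHalfLaw
  infer_instance

theorem map_exp_logHalfLaw (ε : ℝ) (μ : Measure ℝ) :
    (logHalfLaw ε μ).map Real.exp = halfLaw ε μ := by
  rw [logHalfLaw, Measure.map_map Real.measurable_exp Real.measurable_log]
  conv_rhs => rw [← Measure.map_id (μ := halfLaw ε μ)]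
  refine Measure.map_congr ?_
  filter_upwards [ae_restrict_mem measurableSet_Ioi] with x hx
  exact Real.exp_log hx

theorem indicator_Ioi_exp_mul_log {t : ℝ} (ht : 0 < t) :
    (Set.Ioi (0 : ℝ)).indicator (fun x => Real.exp (t * Real.log x)) = posPow t := by
  funext x
  rcases le_or_gt x 0 with hx | hx
  · rw [Set.indicator_of_notMem (by simpa using hx), posPow_of_nonpos ht.ne' hx]
  · rw [Set.indicator_of_mem (Set.mem_Ioi.2 hx), posPow_of_pos _ hx,
      Real.rpow_def_of_pos hx, mul_comm]

theorem integrable_logHalfLaw {t : ℝ} (ht : 0 < t)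
    (h : Integrable (fun x => posPow t (ε * x)) μ) :
    Integrable (fun x => Real.exp (t * x)) (logHalfLaw ε μ) := by
  rw [logHalfLaw, integrable_map_measure (by fun_prop) (by fun_prop), halfLaw]
  change IntegrableOn (fun x => Real.exp (t * Real.log x)) _ _
  rw [← integrable_indicator_iff measurableSet_Ioi, indicator_Ioi_exp_mul_log ht,
    integrable_map_measure (continuous_posPow ht.le).aestronglyMeasurable (by fun_prop)]
  exact h

theorem mgf_logHalfLaw {t : ℝ} (ht : 0 < t) :
    mgf id (logHalfLaw ε μ) t = ∫ x, posPow t (ε * x) ∂μ := by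
  rw [mgf, logHalfLaw, integral_map (by fun_prop) (by fun_prop), halfLaw]
  simp only [id]
  rw [← integral_indicator measurableSet_Ioi, indicator_Ioi_exp_mul_log ht,
    integral_map (by fun_prop) (continuous_posPow ht.le).aestronglyMeasurable]

/-- All absolute moments of `μ` exist, and the Mellin transforms of its two halves satisfy the
difference equation of the product normal law. -/
structure PowerMomentRecursion (n : ℕ) (σ : ℝ) (μ : Measure ℝ) : Prop where
  integrable : ∀ ε : ℝ, ε * ε = 1 → ∀ s > 0, Integrable (fun x => posPow s (ε * x)) μ
  integral_eq : ∀ ε : ℝ, ε * ε = 1 → ∀ s > (n : ℝ),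
    ∫ x, posPow (s + 2) (ε * x) ∂μ = σ ^ 2 * (s + 1) ^ n * ∫ x, posPow s (ε * x) ∂μ

theorem tendsto_difference_ratio (n : ℕ) {c : ℝ} (hc : c ≠ 0) :
    Filter.Tendsto (fun s : ℝ => (c * (s + 2 + 1) ^ n) / (c * (s + 1) ^ n)) Filter.atTop
      (nhds 1) := by
  have h1 : Filter.Tendsto (fun s : ℝ => (1 + 2 / (s + 1)) ^ n) Filter.atTop (nhds 1) := by
    have := ((tendsto_const_nhds (x := (2 : ℝ))).div_atTop
      (Filter.tendsto_atTop_add_const_right Filter.atTop (1 : ℝ) Filter.tendsto_id)).const_add 1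
    simpa using this.pow n
  refine h1.congr' ?_
  filter_upwards [Filter.eventually_gt_atTop 0] with s hs
  have : s + 1 ≠ 0 := by positivity
  rw [mul_div_mul_left _ _ hc, ← div_pow]
  congr 1
  field_simp
  ring

theorem logHalfLaw_ne_zero [IsFiniteMeasure μ] {t : ℝ} (ht : 0 < t)
    (h : ∫ x, posPow t (ε * x) ∂μ ≠ 0) : logHalfLaw ε μ ≠ 0 := fun h0 => h <| by
  rw [← mgf_logHalfLaw ht, h0]
  simp

/-- The Mellin transform of a half is the moment generating function of its logarithm, so the
Bohr–Mollerup argument applies with `φ t = σ² (t+1)ⁿ`. A null half of `μ` is covered by `C = 0`;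
`h0` excludes a null half of `ν`. -/
theorem PowerMomentRecursion.exists_halfLaw_eq [IsFiniteMeasure μ] [IsFiniteMeasure ν] {n : ℕ}
    {σ : ℝ} (hσ : σ ≠ 0) (hμ : PowerMomentRecursion n σ μ) (hν : PowerMomentRecursion n σ ν)
    (hε : ε * ε = 1) (h0 : ∫ x, posPow 1 (ε * x) ∂ν ≠ 0) :
    ∃ C : NNReal, halfLaw ε μ = C • halfLaw ε ν ∧
      ∀ s > 0, ∫ x, posPow s (ε * x) ∂μ = C * ∫ x, posPow s (ε * x) ∂ν := by
  suffices h : ∃ C : NNReal, logHalfLaw ε μ = C • logHalfLaw ε ν by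
    obtain ⟨C, hC⟩ := h
    refine ⟨C, ?_, fun s hs => ?_⟩
    · rw [← map_exp_logHalfLaw, hC, Measure.map_smul, map_exp_logHalfLaw]
    · rw [← mgf_logHalfLaw hs, ← mgf_logHalfLaw hs, hC]
      simp only [mgf, integral_smul_nnreal_measure]
      rfl
  by_cases hz : logHalfLaw ε μ = 0
  · exact ⟨0, by rw [hz, zero_smul]⟩
  have : NeZero (logHalfLaw ε μ) := ⟨hz⟩
  have : NeZero (logHalfLaw ε ν) := ⟨logHalfLaw_ne_zero one_pos h0⟩
  have hn0 : (0 : ℝ) ≤ n := n.cast_nonneg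
  have hi := fun t (ht : t > 0) => integrable_logHalfLaw ht (hμ.integrable ε hε t ht)
  have hi' := fun t (ht : t > 0) => integrable_logHalfLaw ht (hν.integrable ε hε t ht)
  obtain ⟨C, hC⟩ := exists_mgf_eq_mul_of_difference_eq (a := n)
    (fun t ht => hi t (hn0.trans_lt ht)) (fun t ht => hi' t (hn0.trans_lt ht))
    (φ := fun t => σ ^ 2 * (t + 1) ^ n)
    (fun t ht => by
      have : 0 < t := hn0.trans_lt ht
      positivity)
    (tendsto_difference_ratio n (pow_ne_zero 2 hσ))
    (fun t ht => by
      have : 0 < t := hn0.trans_lt ht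
      rw [mgf_logHalfLaw this, mgf_logHalfLaw (by linarith)]
      exact hμ.integral_eq ε hε t ht)
    (fun t ht => by
      have : 0 < t := hn0.trans_lt ht
      rw [mgf_logHalfLaw this, mgf_logHalfLaw (by linarith)]
      exact hν.integral_eq ε hε t ht)
  refine ⟨C, Measure.ext_of_mgf_eqOn_Ioi (a := n) hi
    (fun t ht => (hi' t ht).smul_measure_nnreal) fun t ht => ?_⟩
  rw [hC t ht]
  simp only [mgf, integral_smul_nnreal_measure]
  rfl

theorem posPow_one_sub (x : ℝ) : posPow 1 (1 * x) - posPow 1 (-1 * x) = x := by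
  simp only [posPow, Real.rpow_one, one_mul, neg_one_mul]
  rcases le_total x 0 with h | h
  · rw [max_eq_right h, max_eq_left (by linarith)]
    ring
  · rw [max_eq_left h, max_eq_right (by linarith)]
    ring

theorem posPow_two_add (x : ℝ) : posPow 2 (1 * x) + posPow 2 (-1 * x) = x ^ 2 := by
  simp only [posPow, Real.rpow_two, one_mul, neg_one_mul]
  rcases le_total x 0 with h | h
  · rw [max_eq_right h, max_eq_left (by linarith)]
    ring
  · rw [max_eq_left h, max_eq_right (by linarith)]
    ring

/-- The halves miss only the atom at 0, which total mass one recovers. -/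
theorem Measure.eq_of_halfLaw_eq [IsProbabilityMeasure μ] [IsProbabilityMeasure ν]
    (h1 : halfLaw 1 μ = halfLaw 1 ν) (h2 : halfLaw (-1) μ = halfLaw (-1) ν) : μ = ν := by
  have hpos : ∀ B, MeasurableSet B → μ (B ∩ Set.Ioi 0) = ν (B ∩ Set.Ioi 0) := fun B hB => by
    have := congrArg (fun m => m B) h1
    simpa [halfLaw, Measure.restrict_apply hB] using this
  have hneg : ∀ B, MeasurableSet B → μ (B ∩ Set.Iio 0) = ν (B ∩ Set.Iio 0) := fun B hB => by
    have hm : Measurable fun x : ℝ => -1 * x := measurable_const_mul _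
    have := congrArg (fun m => m ((fun x => -1 * x) ⁻¹' B)) h2
    simp only [halfLaw, Measure.restrict_apply (hm hB)] at this
    rw [Measure.map_apply hm ((hm hB).inter measurableSet_Ioi),
      Measure.map_apply hm ((hm hB).inter measurableSet_Ioi)] at this
    have e : (fun x : ℝ => -1 * x) ⁻¹' ((fun x => -1 * x) ⁻¹' B ∩ Set.Ioi 0) =
        B ∩ Set.Iio 0 := by
      ext x
      simp
    rwa [e] at this
  have hne : ∀ B, MeasurableSet B → μ (B \ {0}) = ν (B \ {0}) := fun B hB => by
    have e : B \ {0} = B ∩ Set.Ioi 0 ∪ B ∩ Set.Iio 0 := by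
      ext x
      simp only [Set.mem_sdiff, Set.mem_singleton_iff, Set.mem_union, Set.mem_inter_iff,
        Set.mem_Ioi, Set.mem_Iio]
      constructor
      · rintro ⟨hB, hx⟩
        rcases lt_or_gt_of_ne hx with h | h
        · exact Or.inr ⟨hB, h⟩
        · exact Or.inl ⟨hB, h⟩
      · rintro (⟨hB, hx⟩ | ⟨hB, hx⟩)
        · exact ⟨hB, hx.ne'⟩
        · exact ⟨hB, hx.ne⟩
    have hd : Disjoint (B ∩ Set.Ioi 0) (B ∩ Set.Iio 0) := by
      refine Set.disjoint_left.2 fun x hx hx' => ?_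
      exact lt_asymm (Set.mem_Ioi.1 hx.2) (Set.mem_Iio.1 hx'.2)
    rw [e, measure_union hd (hB.inter measurableSet_Iio),
      measure_union hd (hB.inter measurableSet_Iio), hpos B hB, hneg B hB]
  have hzero : μ {0} = ν {0} := by
    have h := hne _ MeasurableSet.univ
    rw [← Set.compl_eq_univ_sdiff, prob_compl_eq_one_sub (measurableSet_singleton 0),
      prob_compl_eq_one_sub (measurableSet_singleton 0)] at h
    exact (ENNReal.sub_right_inj ENNReal.one_ne_top prob_le_one prob_le_one).1 h
  ext B hB
  by_cases h0 : (0 : ℝ) ∈ B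
  · rw [← Set.insert_eq_of_mem h0, ← Set.insert_sdiff_singleton, Set.insert_eq,
      measure_union Set.disjoint_sdiff_right (hB.diff (measurableSet_singleton 0)),
      measure_union Set.disjoint_sdiff_right (hB.diff (measurableSet_singleton 0)), hzero,
      hne B hB]
  · rw [← Set.sdiff_singleton_eq_self h0, hne B hB]

theorem PowerMomentRecursion.unique [IsProbabilityMeasure μ] [IsProbabilityMeasure ν] {n : ℕ}
    {σ : ℝ} (hσ : σ ≠ 0) (hμ : PowerMomentRecursion n σ μ) (hν : PowerMomentRecursion n σ ν)
    (hμ1 : ∫ x, x ∂μ = 0) (hν1 : ∫ x, x ∂ν = 0) (hμ2 : ∫ x, x ^ 2 ∂μ = σ ^ 2)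
    (hν2 : ∫ x, x ^ 2 ∂ν = σ ^ 2) : μ = ν := by
  have e1 : (1 : ℝ) * 1 = 1 := one_mul 1
  have e2 : (-1 : ℝ) * -1 = 1 := by norm_num
  have hmean : ∀ ρ : Measure ℝ, PowerMomentRecursion n σ ρ → ∫ x, x ∂ρ = 0 →
      ∫ x, posPow 1 (1 * x) ∂ρ = ∫ x, posPow 1 (-1 * x) ∂ρ := fun ρ hρ h => by
    rw [← sub_eq_zero, ← integral_sub (hρ.integrable 1 e1 1 one_pos)
      (hρ.integrable (-1) e2 1 one_pos)]
    simpa only [posPow_one_sub] using h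
  have hsq : ∀ ρ : Measure ℝ, PowerMomentRecursion n σ ρ → ∫ x, x ^ 2 ∂ρ = σ ^ 2 →
      ∫ x, posPow 2 (1 * x) ∂ρ + ∫ x, posPow 2 (-1 * x) ∂ρ = σ ^ 2 := fun ρ hρ h => by
    rw [← integral_add (hρ.integrable 1 e1 2 two_pos) (hρ.integrable (-1) e2 2 two_pos)]
    simpa only [posPow_two_add] using h
  -- Otherwise, the mean being zero, both halves have zero first moment, and `ν` sits at 0 against
  -- its second moment `σ²`.
  have hA : ∫ x, posPow 1 (1 * x) ∂ν ≠ 0 := fun h => by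
    have h' := h
    rw [hmean ν hν hν1] at h'
    rw [integral_eq_zero_iff_of_nonneg (fun x => posPow_nonneg _ _)
      (hν.integrable 1 e1 1 one_pos)] at h
    rw [integral_eq_zero_iff_of_nonneg (fun x => posPow_nonneg _ _)
      (hν.integrable (-1) e2 1 one_pos)] at h'
    have : ∫ x, x ^ 2 ∂ν = 0 := by
      refine integral_eq_zero_of_ae ?_
      filter_upwards [h, h'] with x hx hx'
      have hz := posPow_one_sub x
      simp only [Pi.zero_apply] at hx hx' ⊢
      rw [hx, hx', sub_zero] at hz
      rw [← hz]
      norm_num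
    rw [hν2] at this
    exact pow_ne_zero 2 hσ this
  obtain ⟨C, hC, hCs⟩ := hμ.exists_halfLaw_eq hσ hν e1 hA
  obtain ⟨D, hD, hDs⟩ := hμ.exists_halfLaw_eq hσ hν e2 (by rwa [← hmean ν hν hν1])
  have hCD : (C : ℝ) = D := by
    have h := hmean μ hμ hμ1
    rw [hCs 1 one_pos, hDs 1 one_pos, ← hmean ν hν hν1] at h
    exact mul_right_cancel₀ hA h
  have hC1 : (C : ℝ) = 1 := by
    have h := hsq μ hμ hμ2
    rw [hCs 2 two_pos, hDs 2 two_pos, ← hCD, ← mul_add, hsq ν hν hν2] at h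
    exact mul_right_cancel₀ (pow_ne_zero 2 hσ) (h.trans (one_mul _).symm)
  have hD1 : D = 1 := by
    rw [hCD] at hC1
    exact_mod_cast hC1
  have hC1' : C = 1 := by exact_mod_cast hC1
  rw [hC1', one_smul] at hC
  rw [hD1, one_smul] at hD
  exact Measure.eq_of_halfLaw_eq hC hD

end

/-! ### Existence of moments from the zero bias identity -/

/-- A bounded smooth truncation of `x ↦ x²ᵏ⁺¹`. -/
noncomputable def cutoffPow (η : ℝ) (k : ℕ) (x : ℝ) : ℝ :=
  x ^ (2 * k + 1) * ((1 + η * x ^ 2) ^ (k + 1))⁻¹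

/-- The action of `T` on `x ↦ p(ηx²/(1+ηx²)) * cutoffPow η k x`, in terms of `p`. -/
noncomputable def cutoffOp (k : ℕ) (p : Polynomial ℝ) : Polynomial ℝ :=
  (Polynomial.C (2 * k + 1 : ℝ) - Polynomial.C (2 * (k + 1) : ℝ) * Polynomial.X) * p +
    2 * Polynomial.X * (1 - Polynomial.X) * p.derivative

section
variable {η : ℝ}

/-- With `v = ηx²/(1+ηx²)` one has `T v = 2v(1-v)`, and `T` multiplies the cutoff by `2k+1 -
2(k+1)v`. Hence `T` acts on polynomials in `v` by an operator free of `η`. -/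
theorem hasDerivAt_eval_mul_cutoffPow (hη : 0 ≤ η) (k : ℕ) (p : Polynomial ℝ) (x : ℝ) :
    HasDerivAt (fun x => p.eval (η * x ^ 2 / (1 + η * x ^ 2)) * cutoffPow η k x)
      ((cutoffOp k p).eval (η * x ^ 2 / (1 + η * x ^ 2)) *
        (x ^ (2 * k) * ((1 + η * x ^ 2) ^ (k + 1))⁻¹)) x := by
  have hpos : 0 < 1 + η * x ^ 2 := by positivity
  have hq : HasDerivAt (fun x : ℝ => η * x ^ 2) (η * (2 * x)) x := by
    simpa using (hasDerivAt_pow 2 x).const_mul η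
  have hd : HasDerivAt (fun x : ℝ => 1 + η * x ^ 2) (η * (2 * x)) x := hq.const_add 1
  have hv := (p.hasDerivAt (η * x ^ 2 / (1 + η * x ^ 2))).comp x (hq.fun_div hd hpos.ne')
  have hf := (hasDerivAt_pow (2 * k + 1) x).mul ((hd.pow (k + 1)).inv (pow_pos hpos _).ne')
  refine (hv.mul hf).congr_deriv ?_
  simp only [cutoffOp, Polynomial.eval_add, Polynomial.eval_mul, Polynomial.eval_sub,
    Polynomial.eval_C, Polynomial.eval_X, Polynomial.eval_one, Polynomial.eval_ofNat,
    Nat.add_sub_cancel, Function.comp_apply, Pi.mul_apply, Pi.pow_apply, Pi.inv_apply]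
  generalize Polynomial.eval _ p.derivative = b
  generalize Polynomial.eval _ p = a
  push_cast
  field_simp
  ring

theorem opT_iterate_cutoffPow (hη : 0 ≤ η) (k m : ℕ) :
    opT^[m] (cutoffPow η k) = fun x =>
      ((cutoffOp k)^[m] 1).eval (η * x ^ 2 / (1 + η * x ^ 2)) * cutoffPow η k x := by
  induction m with
  | zero => simp
  | succ m ih =>
    rw [Function.iterate_succ_apply', ih, Function.iterate_succ_apply']
    funext x
    rw [opT, (hasDerivAt_eval_mul_cutoffPow hη k _ x).deriv, cutoffPow]
    ring

theorem opA_cutoffPow (hη : 0 ≤ η) (k : ℕ) {n : ℕ} (hn : 1 ≤ n) (x : ℝ) :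
    opA n (cutoffPow η k) x = ((cutoffOp k)^[n] 1).eval (η * x ^ 2 / (1 + η * x ^ 2)) *
        (x ^ (2 * k) * ((1 + η * x ^ 2) ^ (k + 1))⁻¹) := by
  obtain ⟨m, rfl⟩ : ∃ m, n = m + 1 := ⟨n - 1, by omega⟩
  rw [opA, Nat.add_sub_cancel, opT_iterate_cutoffPow hη,
    (hasDerivAt_eval_mul_cutoffPow hη k _ x).deriv, Function.iterate_succ_apply']

/-- The polynomial does not involve `η` and its argument stays in `[0, 1]`, so its maximum there
serves for every `η`. -/
theorem exists_abs_opA_cutoffPow_le (k : ℕ) {n : ℕ} (hn : 1 ≤ n) :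
    ∃ M, 0 ≤ M ∧ ∀ η ≥ 0, ∀ x, |opA n (cutoffPow η k) x| ≤ M * x ^ (2 * k) := by
  obtain ⟨M, hM⟩ := (isCompact_Icc (a := (0 : ℝ)) (b := 1)).exists_bound_of_continuousOn
    ((cutoffOp k)^[n] 1).continuous.continuousOn
  have hM0 : 0 ≤ M := (norm_nonneg _).trans (hM 0 (by simp))
  refine ⟨M, hM0, fun η hη x => ?_⟩
  have hx : 0 ≤ η * x ^ 2 := by positivity
  have hp : 0 ≤ x ^ (2 * k) := by rw [pow_mul]; positivity
  rw [opA_cutoffPow hη k hn, abs_mul, abs_mul, abs_of_nonneg hp, abs_inv,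
    abs_of_nonneg (by positivity : 0 ≤ (1 + η * x ^ 2) ^ (k + 1))]
  refine mul_le_mul (hM _ ⟨by positivity, ?_⟩) ?_ (by positivity) hM0
  · rw [div_le_one (by positivity)]
    linarith
  · exact mul_le_of_le_one_right hp (inv_le_one_of_one_le₀ (one_le_pow₀ (by linarith)))

theorem contDiff_cutoffPow (hη : 0 ≤ η) (k n : ℕ) : ContDiff ℝ n (cutoffPow η k) := by
  have h : ∀ x : ℝ, (1 + η * x ^ 2) ^ (k + 1) ≠ 0 := fun x => by positivity
  unfold cutoffPow
  exact ContDiff.mul (by fun_prop) (ContDiff.inv (by fun_prop) h)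

theorem mul_cutoffPow (η : ℝ) (k : ℕ) (x : ℝ) :
    x * cutoffPow η k x = (x ^ 2 / (1 + η * x ^ 2)) ^ (k + 1) := by
  rw [cutoffPow, div_pow, ← pow_mul]
  ring

theorem mul_cutoffPow_nonneg (hη : 0 ≤ η) (k : ℕ) (x : ℝ) : 0 ≤ x * cutoffPow η k x := by
  rw [mul_cutoffPow]
  positivity

theorem mul_cutoffPow_le (hη : 0 < η) (k : ℕ) (x : ℝ) :
    x * cutoffPow η k x ≤ (η⁻¹) ^ (k + 1) := by
  rw [mul_cutoffPow]
  refine pow_le_pow_left₀ (by positivity) ?_ _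
  rw [div_le_iff₀ (by positivity)]
  field_simp
  linarith

/-- For `η = R⁻²` the denominator `1 + ηx²` is at most 2 on `|x| ≤ R`. -/
theorem pow_le_mul_cutoffPow {R : ℝ} (hR : 0 < R) (k : ℕ) {x : ℝ} (hx : |x| ≤ R) :
    x ^ (2 * (k + 1)) ≤ 2 ^ (k + 1) * (x * cutoffPow ((R ^ 2)⁻¹) k x) := by
  have h : x ^ 2 ≤ R ^ 2 := sq_le_sq' (by linarith [abs_le.1 hx]) (abs_le.1 hx).2
  rw [mul_cutoffPow, ← mul_pow, pow_mul]
  refine pow_le_pow_left₀ (by positivity) ?_ _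
  have h2 : (R ^ 2)⁻¹ * x ^ 2 ≤ 1 := by
    rw [inv_mul_le_iff₀ (by positivity)]
    linarith
  rw [← mul_div_assoc, le_div_iff₀ (by positivity)]
  nlinarith [sq_nonneg x]

end

/-- Odd powers cannot be inserted before the moments exist, but their cutoffs can: `x f` is bounded
and `Aₙ f` is dominated by the previous moment. The identity then bounds `E[x f]` uniformly in `η`,
hence the next moment on every ball. -/
theorem integrable_pow_of_zeroBias {n : ℕ} (hn : 1 ≤ n) {μ : Measure ℝ} [IsProbabilityMeasure μ]
    {c : ℝ} (hc : 0 ≤ c) (h : ∀ f : ℝ → ℝ, TimesDifferentiable n f →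
      Integrable (fun x => x * f x) μ → Integrable (opA n f) μ →
      ∫ x, x * f x ∂μ = c * ∫ x, opA n f x ∂μ) (k : ℕ) :
    Integrable (fun x => x ^ (2 * k)) μ := by
  induction k with
  | zero => simp
  | succ k ih =>
    obtain ⟨M, hM0, hM⟩ := exists_abs_opA_cutoffPow_le k hn
    have hnn : ∀ (k : ℕ) (x : ℝ), 0 ≤ x ^ (2 * k) := fun k x => by rw [pow_mul]; positivity
    have hi : ∀ η > 0, Integrable (fun x => x * cutoffPow η k x) μ := fun η hη => by
      refine (integrable_const ((η⁻¹) ^ (k + 1))).mono'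
        (continuous_id.mul (contDiff_cutoffPow hη.le k 0).continuous).aestronglyMeasurable
        (.of_forall fun x => ?_)
      rw [Real.norm_of_nonneg (mul_cutoffPow_nonneg hη.le k x)]
      exact mul_cutoffPow_le hη k x
    have hle : ∀ η > 0, ∫ x, x * cutoffPow η k x ∂μ ≤ c * (M * ∫ x, x ^ (2 * k) ∂μ) :=
        fun η hη => by
      have hA : Integrable (opA n (cutoffPow η k)) μ :=
        (ih.const_mul M).mono' (measurable_deriv _).aestronglyMeasurable
          (.of_forall fun x => hM η hη.le x)
      rw [h _ (timesDifferentiable_of_contDiff (contDiff_cutoffPow hη.le k n)) (hi η hη) hA]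
      refine mul_le_mul_of_nonneg_left ?_ hc
      rw [← integral_const_mul]
      exact integral_mono hA (ih.const_mul M) fun x => (le_abs_self _).trans (hM η hη.le x)
    have hcover : AECover μ Filter.atTop fun m : ℕ => Metric.closedBall (0 : ℝ) ((m : ℝ) + 1) :=
      aecover_closedBall (Filter.tendsto_atTop_add_const_right _ _ tendsto_natCast_atTop_atTop)
    have hcont : Continuous fun x : ℝ => x ^ (2 * (k + 1)) := by fun_prop
    refine hcover.integrable_of_integral_bounded_of_nonneg_ae
      (2 ^ (k + 1) * (c * (M * ∫ x, x ^ (2 * k) ∂μ)))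
      (fun m => hcont.continuousOn.integrableOn_compact (isCompact_closedBall _ _))
      (.of_forall fun x => hnn _ x) (.of_forall fun m => ?_)
    have hR : (0 : ℝ) < (m : ℝ) + 1 := by positivity
    have hη : (((m : ℝ) + 1) ^ 2)⁻¹ > 0 := by positivity
    have hi2 := (hi _ hη).const_mul (2 ^ (k + 1))
    calc ∫ x in Metric.closedBall (0 : ℝ) ((m : ℝ) + 1), x ^ (2 * (k + 1)) ∂μ
        ≤ ∫ x in Metric.closedBall (0 : ℝ) ((m : ℝ) + 1),
            2 ^ (k + 1) * (x * cutoffPow ((((m : ℝ) + 1) ^ 2)⁻¹) k x) ∂μ := by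
          refine setIntegral_mono_on
            (hcont.continuousOn.integrableOn_compact (isCompact_closedBall _ _)) hi2.integrableOn
            Metric.isClosed_closedBall.measurableSet fun x hx => ?_
          exact pow_le_mul_cutoffPow hR k (by simpa using hx)
      _ ≤ ∫ x, 2 ^ (k + 1) * (x * cutoffPow ((((m : ℝ) + 1) ^ 2)⁻¹) k x) ∂μ :=
          setIntegral_le_integral hi2 (.of_forall fun x =>
            mul_nonneg (by positivity) (mul_cutoffPow_nonneg hη.le k x))
      _ ≤ _ := by
          rw [integral_const_mul]
          exact mul_le_mul_of_nonneg_left (hle _ hη) (by positivity)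

/-! ### The moment recursion and uniqueness -/

section
variable {n : ℕ} {σ : ℝ} {μ : Measure ℝ}

theorem powerMomentRecursion_of_integral_oneSidedPow (hn : 1 ≤ n)
    (hi : ∀ ε : ℝ, ε * ε = 1 → ∀ s > 0, Integrable (fun x => posPow s (ε * x)) μ)
    (h : ∀ ε : ℝ, ε * ε = 1 → ∀ s > (n : ℝ), ∫ x, x * oneSidedPow ε s x ∂μ =
      σ ^ 2 * ∫ x, opA n (oneSidedPow ε s) x ∂μ) : PowerMomentRecursion n σ μ := by
  refine ⟨hi, fun ε hε s hs => ?_⟩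
  have hs0 : 0 < s := n.cast_nonneg.trans_lt hs
  -- With exponent `s + 1`, `x f` has degree `s + 2` and `Aₙ f` has degree `s`.
  have := h ε hε (s + 1) (by linarith)
  simp only [mul_oneSidedPow ε (show 0 < s + 1 by linarith),
    opA_oneSidedPow hε hn (show 1 < s + 1 by linarith), integral_const_mul,
    add_sub_cancel_right] at this
  rw [show s + 2 = s + 1 + 1 by ring, this, mul_assoc]

theorem powerMomentRecursion_of_zeroBias (hn : 1 ≤ n) [IsProbabilityMeasure μ]
    (h : ∀ f : ℝ → ℝ, TimesDifferentiable n f →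
      Integrable (fun x => x * f x) μ → Integrable (opA n f) μ →
      ∫ x, x * f x ∂μ = σ ^ 2 * ∫ x, opA n f x ∂μ) : PowerMomentRecursion n σ μ := by
  have hi : ∀ ε : ℝ, ε * ε = 1 → ∀ s > 0, Integrable (fun x => posPow s (ε * x)) μ :=
    fun ε hε s hs => integrable_posPow (integrable_pow_of_zeroBias hn (sq_nonneg σ) h) hε hs
  refine powerMomentRecursion_of_integral_oneSidedPow hn hi fun ε hε s hs => ?_
  have hs1 : 1 < s := lt_of_le_of_lt (by exact_mod_cast hn) hs
  refine h _ (timesDifferentiable_of_contDiff (contDiff_oneSidedPow ε hs)) ?_ ?_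
  · simp only [mul_oneSidedPow ε (zero_lt_one.trans hs1)]
    exact hi ε hε _ (by linarith)
  · rw [opA_oneSidedPow hε hn hs1]
    exact (hi ε hε _ (by linarith)).const_mul _

theorem powerMomentRecursion_productNormal (hn : 1 ≤ n) (hσ : σ ≠ 0) :
    PowerMomentRecursion n σ (productNormal n σ) :=
  powerMomentRecursion_of_zeroBias hn fun _ hf _ hA =>
    (stein_productNormal hn hσ hf.iteratesDifferentiable hA).2

theorem posPow_le_of_le {s t : ℝ} (hs : 0 < s) (hst : s ≤ t) (x : ℝ) :
    posPow s x ≤ 1 + posPow t x := by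
  rcases le_or_gt x 0 with hx | hx
  · rw [posPow_of_nonpos hs.ne' hx]
    linarith [posPow_nonneg t x]
  · rw [posPow_of_pos _ hx, posPow_of_pos _ hx]
    rcases le_or_gt x 1 with h1 | h1
    · linarith [Real.rpow_le_one hx.le h1 hs.le, Real.rpow_nonneg hx.le t]
    · linarith [Real.rpow_le_rpow_of_exponent_le h1.le hst]

/-- Beyond `√(2c)` the term `c xˢ` is at most half of `xˢ⁺²`, so the difference controls the larger
power; below it the power is bounded. -/
theorem posPow_add_two_le {s : ℝ} (hs : 0 < s) (c x : ℝ) :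
    posPow (s + 2) x ≤ posPow (s + 2) √(2 * c) + 2 * |c * posPow s x - posPow (s + 2) x| := by
  have habs := abs_nonneg (c * posPow s x - posPow (s + 2) x)
  rcases le_or_gt x √(2 * c) with hx | hx
  · have : posPow (s + 2) x ≤ posPow (s + 2) √(2 * c) :=
      Real.rpow_le_rpow (le_max_right _ _) (max_le_max hx le_rfl) (by linarith)
    linarith
  · have hx0 : 0 < x := (Real.sqrt_nonneg _).trans_lt hx
    have hx2 : 2 * c < x ^ 2 := (Real.sqrt_lt' hx0).1 hx
    have h1 : x ^ 2 * posPow s x = posPow (s + 2) x := by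
      simpa using pow_mul_posPow hs 2 x
    have h2 := posPow_nonneg s x
    have h3 := posPow_nonneg (s + 2) √(2 * c)
    have h4 : 2 * c * posPow s x ≤ posPow (s + 2) x := by
      rw [← h1]
      exact mul_le_mul_of_nonneg_right hx2.le h2
    have := neg_abs_le (c * posPow s x - posPow (s + 2) x)
    linarith

theorem integrable_posPow_of_stein [IsFiniteMeasure μ] {ε : ℝ} {a : ℝ} {c : ℝ → ℝ}
    (h : ∀ s > a, Integrable
      (fun x => c s * posPow s (ε * x) - posPow (s + 2) (ε * x)) μ) {s : ℝ} (hs : 0 < s) :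
    Integrable (fun x => posPow s (ε * x)) μ := by
  set t := max s (a + 1)
  have ht : s ≤ t := le_max_left _ _
  have ht0 : 0 < t := hs.trans_le ht
  have hta : a < t := (lt_add_one a).trans_le (le_max_right _ _)
  have hm : ∀ r > 0, AEStronglyMeasurable (fun x => posPow r (ε * x)) μ := fun r hr =>
    ((continuous_posPow hr.le).comp (continuous_const_mul ε)).aestronglyMeasurable
  refine ((integrable_const (1 + posPow (t + 2) √(2 * c t))).add
    ((h t hta).abs.const_mul 2)).mono' (hm s hs) (.of_forall fun x => ?_)
  rw [Real.norm_of_nonneg (posPow_nonneg _ _)]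
  have h1 := posPow_le_of_le hs (t := t + 2) (by linarith) (ε * x)
  have h2 := posPow_add_two_le ht0 (c t) (ε * x)
  simp only [Pi.add_apply]
  linarith

/-- **Uniqueness in Stein's characterisation** of the product normal law. -/
theorem eq_productNormal_of_stein (hn : 1 ≤ n) (hσ : σ ≠ 0) [IsProbabilityMeasure μ]
    (hμ : ∫ x, x ∂μ = 0)
    (h : ∀ f : ℝ → ℝ, ContDiff ℝ n f →
      Integrable (fun x => x * f x) (productNormal n σ) →
      (∀ k ∈ Finset.Icc 1 n,
        Integrable (fun x => x ^ (k - 1) * iteratedDeriv k f x) (productNormal n σ)) →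
      Integrable (fun x => σ ^ 2 * opA n f x - x * f x) μ ∧
        ∫ x, (σ ^ 2 * opA n f x - x * f x) ∂μ = 0) : μ = productNormal n σ := by
  have hPN := powerMomentRecursion_productNormal hn hσ
  have hone : ∀ ε : ℝ, ε * ε = 1 → ∀ s > (n : ℝ),
      Integrable (fun x => σ ^ 2 * opA n (oneSidedPow ε s) x - x * oneSidedPow ε s x) μ ∧
        ∫ x, (σ ^ 2 * opA n (oneSidedPow ε s) x - x * oneSidedPow ε s x) ∂μ = 0 :=
      fun ε hε s hs => by
    have hs1 : 1 < s := lt_of_le_of_lt (by exact_mod_cast hn) hs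
    refine h _ (contDiff_oneSidedPow ε hs) ?_ fun k hk => ?_
    · simp only [mul_oneSidedPow ε (zero_lt_one.trans hs1)]
      exact hPN.integrable ε hε _ (by linarith)
    · obtain ⟨hk1, hkn⟩ := Finset.mem_Icc.1 hk
      have hks : (k : ℝ) < s := lt_of_le_of_lt (by exact_mod_cast hkn) hs
      obtain ⟨c, hc⟩ := pow_mul_iteratedDeriv_oneSidedPow hε hk1 hks
      rw [hc]
      exact (hPN.integrable ε hε _ (by linarith)).const_mul c
  have hi : ∀ ε : ℝ, ε * ε = 1 → ∀ s > 0, Integrable (fun x => posPow s (ε * x)) μ :=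
      fun ε hε s hs => by
    refine integrable_posPow_of_stein (a := n) (c := fun s => σ ^ 2 * (s + 1) ^ n)
      (fun t ht => ?_) hs
    have ht0 : 0 < t := n.cast_nonneg.trans_lt ht
    have := (hone ε hε (t + 1) (by linarith)).1
    rw [opA_oneSidedPow hε hn (by linarith)] at this
    refine this.congr (.of_forall fun x => ?_)
    simp only [mul_oneSidedPow ε (show 0 < t + 1 by linarith), add_sub_cancel_right]
    rw [show t + 1 + 1 = t + 2 by ring]
    ring
  have hrec : PowerMomentRecursion n σ μ := by
    refine powerMomentRecursion_of_integral_oneSidedPow hn hi fun ε hε s hs => ?_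
    have hs1 : 1 < s := lt_of_le_of_lt (by exact_mod_cast hn) hs
    have h0 := (hone ε hε s hs).2
    rw [integral_sub, sub_eq_zero, integral_const_mul] at h0
    · exact h0.symm
    · rw [opA_oneSidedPow hε hn hs1]
      exact ((hi ε hε _ (by linarith)).const_mul _).const_mul _
    · simp only [mul_oneSidedPow ε (zero_lt_one.trans hs1)]
      exact hi ε hε _ (by linarith)
  -- The variance of `μ` is not prescribed; the test function `x`, with `Aₙ f = 1`, yields it.
  have hsq : ∫ x, x ^ 2 ∂μ = σ ^ 2 := by
    have hid : opA n (fun x : ℝ => x ^ 1) = fun _ => 1 := by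
      rw [opA_of_eigen (opT_pow 1)]
      simp
    have hPN2 := memLp_two_productNormal hn hσ
    obtain ⟨h1, h2⟩ := h (fun x => x ^ 1) (by fun_prop)
      (by simpa [sq] using hPN2.integrable_sq) fun k hk => by
        obtain ⟨hk1, -⟩ := Finset.mem_Icc.1 hk
        obtain ⟨m, rfl⟩ : ∃ m, k = m + 1 := ⟨k - 1, by omega⟩
        have hd : deriv (fun x : ℝ => x ^ 1) = fun _ => 1 := by
          funext x
          simp
        rw [iteratedDeriv_succ', hd]
        cases m with
        | zero => simp
        | succ m => simp [iteratedDeriv_const]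
    rw [hid] at h1 h2
    simp only [mul_one, pow_one, ← sq] at h1 h2
    have hx2 : Integrable (fun x : ℝ => x ^ 2) μ := by
      refine ((integrable_const (σ ^ 2)).sub h1).congr (.of_forall fun x => ?_)
      simp
    rw [integral_sub (integrable_const _) hx2] at h2
    simp only [integral_const, probReal_univ, one_smul] at h2
    linarith
  exact hrec.unique hσ hPN hμ (integral_id_productNormal hn) hsq (integral_sq_productNormal hn hσ)

end

/-! ### The two characterisations -/

theorem proposition2p4 (n : ℕ) (hn : 1 ≤ n) (σ : ℝ) (hσ : 0 < σ) :
    (∀ {Ω : Type*} [MeasurableSpace Ω] (P : Measure Ω) [IsProbabilityMeasure P] (Z : Ω → ℝ),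
      AEMeasurable Z P → MemLp Z 2 P → ∫ ω, Z ω ∂P = 0 → variance Z P ≠ 0 →
      (P.map Z = productNormal n σ ↔
        ∀ f : ℝ → ℝ, ContDiff ℝ n f →
          Integrable (fun x => x * f x) (productNormal n σ) →
          (∀ k ∈ Finset.Icc 1 n,
            Integrable (fun x => x ^ (k - 1) * iteratedDeriv k f x) (productNormal n σ)) →
          Integrable (fun ω => σ ^ 2 * opA n f (Z ω) - Z ω * f (Z ω)) P ∧
            ∫ ω, (σ ^ 2 * opA n f (Z ω) - Z ω * f (Z ω)) ∂P = 0)) ∧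
    (∀ μ : Measure ℝ,
      (variance (fun x : ℝ => x) μ = σ ^ 2 ∧ IsZeroBiasLaw n μ μ) ↔ μ = productNormal n σ) := by
  have hσ0 := hσ.ne'
  refine ⟨fun P _ Z hZ hZ2 hmean hvar => ?_, fun μ => ?_⟩
  · have hmeas : ∀ f : ℝ → ℝ, ContDiff ℝ n f →
        Measurable fun x => σ ^ 2 * opA n f x - x * f x := fun f hf =>
      ((measurable_deriv _).const_mul _).sub (measurable_id.mul hf.continuous.measurable)
    constructor
    · intro hlaw f hf hxf hder
      have hfT := timesDifferentiable_of_contDiff hf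
      have hA := integrable_opA_of_forall_integrable hn (ae_productNormal_ne_zero n hσ0) hfT hder
      have hst := stein_productNormal hn hσ0 hfT.iteratesDifferentiable hA
      have hI := (hA.const_mul (σ ^ 2)).sub hst.1
      have hE : ∫ x, (σ ^ 2 * opA n f x - x * f x) ∂(productNormal n σ) = 0 := by
        rw [integral_sub (hA.const_mul _) hst.1, integral_const_mul, hst.2, sub_self]
      rw [← hlaw] at hI hE
      rw [integral_map hZ (hmeas f hf).aestronglyMeasurable] at hE
      exact ⟨(integrable_map_measure (hmeas f hf).aestronglyMeasurable hZ).1 hI, hE⟩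
    · intro h
      have := Measure.isProbabilityMeasure_map hZ
      refine eq_productNormal_of_stein hn hσ0 ?_ fun f hf h1 h2 => ?_
      · rwa [integral_map hZ (by fun_prop)]
      · rw [integral_map hZ (hmeas f hf).aestronglyMeasurable,
          integrable_map_measure (hmeas f hf).aestronglyMeasurable hZ]
        exact h f hf h1 h2
  · constructor
    · rintro ⟨hvar, hzb⟩
      have := hzb.isProbabilityMeasure_left
      have hz := hzb.integral_eq
      rw [hvar] at hz
      refine (powerMomentRecursion_of_zeroBias hn hz).unique hσ0
        (powerMomentRecursion_productNormal hn hσ0) hzb.mean_eq_zero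
        (integral_id_productNormal hn) ?_ (integral_sq_productNormal hn hσ0)
      rw [← hvar, variance_of_integral_eq_zero (by fun_prop) hzb.mean_eq_zero]
    · rintro rfl
      have hv := variance_productNormal hn hσ0
      refine ⟨hv, inferInstance, memLp_two_productNormal hn hσ0, integral_id_productNormal hn,
        by rw [hv]; exact pow_ne_zero 2 hσ0, inferInstance, fun f hf _ hA => ?_⟩
      rw [hv]
      exact (stein_productNormal hn hσ0 hf.iteratesDifferentiable hA).2
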